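/- Fix $n\ge 2$ and work in type $A_{n-1}$, with simple roots $\alpha_k=\varepsilon_k-\varepsilon_{k+1}$ ($1\le k<n$), positive roots $\varepsilon_i-\varepsilon_j$ ($1\le i<j\le n$) and Weyl group $W=\mathfrak S_n=\langle s_1,\dots,s_{n-1}\rangle$. Let $\lambda$ be a partition with at most $n$ parts and let $B(\lambda)$ be the crystal of semistandard tableaux of shape $\lambda$ with entries in $\{1,\dots,n\}$, with Kashiwara operators $\tilde e_i,\tilde f_i$. The Kashiwara action of $W$ on $B(\lambda)$ is the one for which $s_i(b)=\tilde f_i^{\,k}(b)$ if $k=\langle \mathrm{wt}(b),\alpha_i^\vee\rangle\ge 0$ and $s_i(b)=\tilde e_i^{\,-k}(b)$ if $k<0$. For a positive root $\alpha$, let $w\in W$ be the shortest element with $w(\alpha_1)=\alpha$, and let $\mathrm f_\alpha=w\tilde f_1w^{-1}$ (so $\mathrm f_\alpha(b)=0$ exactly when $\tilde f_1(w^{-1}(b))=0$). For a semistandard tableau $T$ with at least two rows, the cyclage $C(T)$ is obtained by removing the south-west letter $x$ of $T$ (the first letter of the bottom row, the rest of which moves one step to the left) and row-inserting $x$ in the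 remaining tableau. The cocharge $\mathrm{co}(T)$ is the number of cyclages that lead from $T$ to a tableau with at most one row. The charge of $T$ is $\mathrm c(T)=\|\mu\|-\mathrm{co}(T)$, where $\mu=(\mu_1,\dots,\mu_n)$ is the weight of $T$ ($\mu_i$ is the number of entries $i$ in $T$) and $\|\mu\|=\sum_{i=1}^{n}(i-1)\mu_i$. Let $T\in B(\lambda)$ and let $\alpha$ be a positive root such that $\mathrm f_\alpha(T)\ne 0$. Then $$\mathrm{co}(\mathrm f_\alpha(T))=\mathrm{co}(T)\qquad\text{and}\qquad \mathrm c(\mathrm f_\alpha(T))=\mathrm c(T)+|\alpha|,$$ where $|\alpha|$ is the height of $\alpha$, i.e. the number of simple roots in the decomposition of $\alpha$ as a sum of simple roots. -/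

import Mathlib

/-!
Type `A_{n-1}`: the letters are `1, …, n`, the simple reflections and the simple roots are indexed
by `1, …, n - 1`, and weights are functions `ℕ → ℤ` (with `ε_k` the `k`-th unit vector), of which
only the coordinates `1, …, n` matter.
-/

namespace TypeA

/-! ### Roots, Weyl group -/

/-- The `k`-th unit vector `ε_k`. -/
def eps (k : ℕ) : ℕ → ℤ := Pi.single k 1

/-- The simple root `α_k = ε_k - ε_{k+1}`. -/
def simpleRoot (k : ℕ) : ℕ → ℤ := eps k - eps (k + 1)

/-- `α` is a positive root of type `A_{n-1}`, i.e. `α = ε_i - ε_j` with `1 ≤ i < j ≤ n`. -/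
def IsPositiveRoot (n : ℕ) (α : ℕ → ℤ) : Prop :=
  ∃ i j : ℕ, 1 ≤ i ∧ i < j ∧ j ≤ n ∧ α = eps i - eps j

/-- The coefficient of the simple root `α_k` in the decomposition of `α` into simple roots;
see `eq_sum_simpleCoeff`. -/
def simpleCoeff (α : ℕ → ℤ) (k : ℕ) : ℤ := ∑ m ∈ Finset.Icc 1 k, α m

/-- The height `|α|`: the number of simple roots, counted with multiplicity, in the decomposition
of `α` as a sum of simple roots. -/
def height (n : ℕ) (α : ℕ → ℤ) : ℤ := ∑ k ∈ Finset.Ico 1 n, simpleCoeff α k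

/-- `s_i` is the transposition of `i` and `i + 1`. -/
def simpleReflection (i : ℕ) : Equiv.Perm ℕ := Equiv.swap i (i + 1)

/-- The Weyl group `W = 𝔖_n`, generated by `s_1, …, s_{n-1}`. -/
def weylGroup (n : ℕ) : Subgroup (Equiv.Perm ℕ) :=
  Subgroup.closure (simpleReflection '' Set.Ico 1 n)

/-- The action of a permutation on weights, characterized by `w(ε_k) = ε_{w(k)}`. -/
def permWeight (w : Equiv.Perm ℕ) (v : ℕ → ℤ) : ℕ → ℤ := fun k => v (w⁻¹ k)

/-- The word `u = (i_1, …, i_l)` in `{1, …, n-1}` is an expression `w = s_{i_1} ⋯ s_{i_l}`. -/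
def IsExpression (n : ℕ) (u : List ℕ) (w : Equiv.Perm ℕ) : Prop :=
  (∀ i ∈ u, 1 ≤ i ∧ i < n) ∧ (u.map simpleReflection).prod = w

/-- The Coxeter length `ℓ(w)` of `w ∈ W`. -/
noncomputable def coxeterLength (n : ℕ) (w : Equiv.Perm ℕ) : ℕ :=
  sInf {l | ∃ u, IsExpression n u w ∧ u.length = l}

/-- `u` is a reduced expression of `w`. -/
def IsReducedExpression (n : ℕ) (u : List ℕ) (w : Equiv.Perm ℕ) : Prop :=
  IsExpression n u w ∧ u.length = coxeterLength n w

/-- `w` is an element of `W` of shortest length with `w(α_1) = α`. -/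
def IsShortestTo (n : ℕ) (w : Equiv.Perm ℕ) (α : ℕ → ℤ) : Prop :=
  w ∈ weylGroup n ∧ permWeight w (simpleRoot 1) = α ∧
    ∀ w' ∈ weylGroup n, permWeight w' (simpleRoot 1) = α → coxeterLength n w ≤ coxeterLength n w'

/-! ### Tableaux -/

/-- A filling, given by the list of its rows from top to bottom (English notation). -/
abbrev Filling : Type := List (List ℕ)

/-- The list of rows of a semistandard Young tableau. -/
def rowsOf {lam : YoungDiagram} (T : SemistandardYoungTableau lam) : Filling :=
  (List.range (lam.colLen 0)).map fun i => (List.range (lam.rowLen i)).map fun j => T i j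

/-- The vertices of the crystal `B(λ)`: the semistandard tableaux of shape `λ` with entries in
`{1, …, n}`. -/
def crystal (n : ℕ) (lam : YoungDiagram) : Set Filling :=
  {R | ∃ T : SemistandardYoungTableau lam,
    (∀ i j, (i, j) ∈ lam → 1 ≤ T i j ∧ T i j ≤ n) ∧ R = rowsOf T}

/-- The weight `μ` of a tableau: `μ_k` is the number of letters `k`. -/
def wt (T : Filling) (k : ℕ) : ℕ := T.flatten.count k

/-! ### Crystal operators -/

/-- The row reading of a filling: rows are read from right to left and from top to bottom.
Each letter is recorded together with its cell `(row, column)`. -/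
def reading (T : Filling) : List ((ℕ × ℕ) × ℕ) :=
  T.zipIdx.flatMap fun R => (R.1.zipIdx.map fun x => ((R.2, x.2), x.1)).reverse

/-- The subword of letters `i`, `i + 1` that remains after recursively deleting
all factors `i (i+1)`. It has the form `(i+1)^r i^s`. -/
def reducedSubword (i : ℕ) : List ((ℕ × ℕ) × ℕ) → List ((ℕ × ℕ) × ℕ)
  | [] => []
  | p :: w =>
    if p.2 = i then
      match reducedSubword i w with
      | [] => [p]
      | q :: v => if q.2 = i + 1 then v else p :: q :: v
    else if p.2 = i + 1 then p :: reducedSubword i w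
    else reducedSubword i w

/-- Replace the entry in the cell `c` by `x`. -/
def relabel (T : Filling) (c : ℕ × ℕ) (x : ℕ) : Filling :=
  T.modify c.1 fun R => R.set c.2 x

/-- The cells of the letters `x` in the reduced subword for `i`, in reading order. -/
def unpaired (i x : ℕ) (T : Filling) : List (ℕ × ℕ) :=
  ((reducedSubword i (reading T)).filter fun p => p.2 = x).map Prod.fst

/-- The crystal operator `f̃_i` (`none` stands for `0`): the leftmost letter `i` of
`(i+1)^r i^s` becomes `i + 1`. -/
def crystalF (i : ℕ) (T : Filling) : Option Filling :=
  (unpaired i i T).head?.map fun c => relabel T c (i + 1)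

/-- The crystal operator `ẽ_i` (`none` stands for `0`): the rightmost letter `i + 1` of
`(i+1)^r i^s` becomes `i`. -/
def crystalE (i : ℕ) (T : Filling) : Option Filling :=
  (unpaired i (i + 1) T).getLast?.map fun c => relabel T c i

/-- The `k`-th power of a partially defined operator. -/
def iter (g : Filling → Option Filling) : ℕ → Filling → Option Filling
  | 0, T => some T
  | k + 1, T => (iter g k T).bind g

/-- The Kashiwara action of `s_i`: `T ↦ f̃_i^k T` if `k = ⟨wt T, α_i^∨⟩ ≥ 0`, and
`T ↦ ẽ_i^{-k} T` otherwise. On tableaux these powers are never `0`, so that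
the default value of `getD` is not used. -/
def kashiwaraReflection (i : ℕ) (T : Filling) : Filling :=
  if wt T (i + 1) ≤ wt T i then (iter (crystalF i) (wt T i - wt T (i + 1)) T).getD T
  else (iter (crystalE i) (wt T (i + 1) - wt T i) T).getD T

/-- The Kashiwara action of `s_{i_1} ⋯ s_{i_l}`, where `u = (i_1, …, i_l)`. -/
def kashiwaraAction (u : List ℕ) (T : Filling) : Filling := u.foldr kashiwaraReflection T

/-- The conjugate `w f̃_1 w⁻¹` of `f̃_1` by the Kashiwara action of `w = s_{i_1} ⋯ s_{i_l}`, where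
`u = (i_1, …, i_l)`; `none` stands for `0`. If `u` is a reduced expression of the shortest `w ∈ W`
with `w(α_1) = α`, this is the modified crystal operator `f_α`. -/
def modifiedF (u : List ℕ) (T : Filling) : Option Filling :=
  (crystalF 1 (kashiwaraAction u.reverse T)).map (kashiwaraAction u)

/-! ### Cyclage, cocharge, charge -/

/-- Insertion of `x` in a row: `x` replaces the leftmost entry `y > x`, and `y` is
bumped; if there is none, `x` is put at the end of the row. -/
def insertRow : List ℕ → ℕ → List ℕ × Option ℕ
  | [], x => ([x], none)
  | y :: R, x => if x < y then (x :: R, some y) else (y :: (insertRow R x).1, (insertRow R x).2)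

/-- Row insertion of `x` in a tableau: bumped letters are inserted in the next row. -/
def rowInsert : Filling → ℕ → Filling
  | [], x => [[x]]
  | R :: T, x =>
    match insertRow R x with
    | (R', none) => R' :: T
    | (R', some y) => R' :: rowInsert T y

/-- The cyclage `C(T)`: remove the south-west letter `x` (the first letter of the bottom row, whose
other letters move to the left) and row-insert it in the remaining tableau. -/
def cyclage (T : Filling) : Filling :=
  match T.getLast? with
  | some (x :: R) => rowInsert (if R = [] then T.dropLast else T.dropLast ++ [R]) x
  | _ => T

/-- The cocharge `co(T)`: the number of cyclages that lead from `T` to a row tableau. -/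
noncomputable def cocharge (T : Filling) : ℕ :=
  sInf {k | (cyclage^[k] T).length ≤ 1}

/-- `‖μ‖ = ∑_{i=1}^n (i-1) μ_i`. -/
def weightNorm (n : ℕ) (μ : ℕ → ℕ) : ℤ := ∑ i ∈ Finset.Icc 1 n, ((i : ℤ) - 1) * μ i

/-- The charge `c(T) = ‖μ‖ - co(T)`, where `μ` is the weight of `T`. -/
noncomputable def charge (n : ℕ) (T : Filling) : ℤ := weightNorm n (wt T) - cocharge T

/-- `simpleCoeff` does give the decomposition of a positive root into simple roots. -/
theorem eq_sum_simpleCoeff {n : ℕ} {α : ℕ → ℤ} (h : IsPositiveRoot n α) :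
    α = ∑ k ∈ Finset.Ico 1 n, simpleCoeff α k • simpleRoot k := by
  obtain ⟨i, j, hi, hij, hj, rfl⟩ := h
  have hc : ∀ k, simpleCoeff (eps i - eps j) k = if i ≤ k ∧ k < j then 1 else 0 := by
    intro k
    simp only [simpleCoeff, eps, Pi.sub_apply, Finset.sum_sub_distrib, Pi.single_apply,
      Finset.sum_ite_eq', Finset.mem_Icc]
    split_ifs <;> omega
  have hs : ∀ m, i ≤ m → ∑ k ∈ Finset.Ico i m, simpleRoot k = eps i - eps m := by
    intro m hm
    induction m, hm using Nat.le_induction with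
    | base => simp
    | succ m hm ih => rw [Finset.sum_Ico_succ_top hm, ih, simpleRoot]; abel
  simp only [hc, ite_smul, one_smul, zero_smul]
  rw [← Finset.sum_filter, ← hs j hij.le]
  congr 1
  ext k
  simp only [Finset.mem_Ico, Finset.mem_filter]
  omega

end TypeA

namespace TypeA

/-! ### Signatures of words and the raising relation -/

/-! Everything is transported to the row word, in which `f̃_i` changes the last unpaired `i` into `i
+ 1`; this is the relation `Raise`. The cyclage of a tableau with word `x v` rotates this word to `v
x` and then row-inserts `x`, so the proof compares crystal operators with these two operations.

Row insertion commutes with every `f̃_i`, and the resulting shapes agree (`raise_rowInsert`). This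
follows row by row from the tensor product rule `raise_append` and from the fact that inserting `x`
in a row `R` replaces the factor `R x` by `y R'` with the same signature.

Rotation does not commute with a single `f̃_i` in general, but it commutes with the reflection `s_i`
(`Reflects.rotate`). Hence tableaux related by `s_i` have cyclages of equal shape that are again
related by `s_i`, and the Kashiwara action preserves the cocharge.

For `f̃_1` rotation is harmless as long as there are two rows: letters `1` occur only in the first
row, so the south-west letter is at least `2` and is neither raised nor able to influence which `1`
is raised. Thus `f̃_1` preserves the cocharge, and so does its conjugate by `w`.

The Kashiwara action permutes weights, so `f_α` subtracts `w(α_1) = α = ε_i - ε_j` from the weight.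
This increases `‖μ‖` by `j - i`, the height of `α`, and the charge grows by the same amount. -/

/-- The numbers of letters `i` and `i + 1` left in a word after deleting recursively all factors
`(i+1) i`. -/
def signature (i : ℕ) : List ℕ → ℕ × ℕ
  | [] => (0, 0)
  | c :: w =>
    if c = i then ((signature i w).1 + 1, (signature i w).2)
    else if c = i + 1 then ((signature i w).1 - 1, (signature i w).2 + (1 - (signature i w).1))
    else signature i w

/-- The number of unpaired letters `i`. -/
def lo (i : ℕ) (w : List ℕ) : ℕ := (signature i w).1

/-- The number of unpaired letters `i + 1`. -/
def hi (i : ℕ) (w : List ℕ) : ℕ := (signature i w).2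

@[simp] theorem lo_nil (i : ℕ) : lo i [] = 0 := rfl
@[simp] theorem hi_nil (i : ℕ) : hi i [] = 0 := rfl

/-- The reduced forms are `i^lo (i+1)^hi`. In a product the unpaired `i + 1` of `u` cancel against
the unpaired `i` of `v`; truncated subtraction records what survives. -/
theorem signature_append (i : ℕ) (u v : List ℕ) :
    lo i (u ++ v) = lo i u + (lo i v - hi i u) ∧ hi i (u ++ v) = hi i v + (hi i u - lo i v) := by
  unfold lo hi
  induction u with
  | nil => simp [signature]
  | cons c u ih =>
    simp only [List.cons_append, signature]
    split_ifs <;> (try dsimp only) <;> omega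

theorem lo_append (i : ℕ) (u v : List ℕ) : lo i (u ++ v) = lo i u + (lo i v - hi i u) :=
  (signature_append i u v).1

theorem hi_append (i : ℕ) (u v : List ℕ) : hi i (u ++ v) = hi i v + (hi i u - lo i v) :=
  (signature_append i u v).2

theorem lo_singleton (i x : ℕ) : lo i [x] = if x = i then 1 else 0 := by
  unfold lo signature; split_ifs <;> simp [signature]

theorem hi_singleton (i x : ℕ) : hi i [x] = if x = i + 1 then 1 else 0 := by
  unfold hi signature; split_ifs <;> simp_all [signature]

theorem lo_cons (i x : ℕ) (w : List ℕ) : lo i (x :: w) = lo i [x] + (lo i w - hi i [x]) :=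
  lo_append i [x] w

theorem hi_cons (i x : ℕ) (w : List ℕ) : hi i (x :: w) = hi i w + (hi i [x] - lo i w) :=
  hi_append i [x] w

theorem lo_eq_zero {i : ℕ} {w : List ℕ} (h : i ∉ w) : lo i w = 0 := by
  induction w with
  | nil => rfl
  | cons c w ih =>
    simp only [List.mem_cons, not_or] at h
    rw [lo_cons, lo_singleton, if_neg (Ne.symm h.1), ih h.2]; simp

theorem hi_eq_zero {i : ℕ} {w : List ℕ} (h : i + 1 ∉ w) : hi i w = 0 := by
  induction w with
  | nil => rfl
  | cons c w ih =>
    simp only [List.mem_cons, not_or] at h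
    rw [hi_cons, hi_singleton, if_neg (Ne.symm h.1), ih h.2]; simp

/-- Each deleted factor contains one letter of either kind, so `lo - hi` is the pairing of the
weight with the coroot, and depends on the weight only. -/
theorem count_signature (i : ℕ) (w : List ℕ) :
    w.count i + hi i w = w.count (i + 1) + lo i w := by
  induction w with
  | nil => rfl
  | cons c w ih =>
    rw [hi_cons, lo_cons, hi_singleton, lo_singleton, List.count_cons, List.count_cons]
    simp only [beq_iff_eq]
    split_ifs <;> omega

/-- `w'` arises from `w` by changing the last unpaired letter `i` to `i + 1`, i.e. `w' = f̃_i w`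
and `w = ẽ_i w'`. -/
def Raise (i : ℕ) (w w' : List ℕ) : Prop :=
  ∃ u v, w = u ++ i :: v ∧ w' = u ++ (i + 1) :: v ∧ hi i u = 0 ∧ lo i v = 0

theorem Raise.signature {i : ℕ} {w w' : List ℕ} (h : Raise i w w') :
    lo i w = lo i w' + 1 ∧ hi i w' = hi i w + 1 := by
  obtain ⟨u, v, rfl, rfl, hu, hv⟩ := h
  simp only [lo_append, hi_append, lo_cons i _ v, hi_cons i _ v, hi_singleton, lo_singleton, hu, hv]
  simp

theorem Raise.length_eq {i : ℕ} {w w' : List ℕ} (h : Raise i w w') : w.length = w'.length := by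
  obtain ⟨u, v, rfl, rfl, hu, hv⟩ := h
  simp

theorem Raise.count {i : ℕ} {w w' : List ℕ} (h : Raise i w w') (k : ℕ) :
    w'.count k + (if k = i then 1 else 0) = w.count k + (if k = i + 1 then 1 else 0) := by
  obtain ⟨u, v, rfl, rfl, hu, hv⟩ := h
  simp only [List.count_append, List.count_cons, beq_iff_eq, eq_comm (a := k)]
  omega

theorem Raise.append_right {i : ℕ} {u u' v : List ℕ} (h : Raise i u u') (hc : lo i v ≤ hi i u) :
    Raise i (u ++ v) (u' ++ v) := by
  obtain ⟨p, q, rfl, rfl, hp, hq⟩ := h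
  refine ⟨p, q ++ v, by simp, by simp, hp, ?_⟩
  simp only [hi_append, hi_cons i _ q, hi_singleton, hp, hq, lo_append] at hc ⊢
  simp at hc ⊢; omega

theorem Raise.append_left {i : ℕ} {u v v' : List ℕ} (h : Raise i v v') (hc : hi i u < lo i v) :
    Raise i (u ++ v) (u ++ v') := by
  obtain ⟨p, q, rfl, rfl, hp, hq⟩ := h
  refine ⟨u ++ p, q, by simp, by simp, ?_, hq⟩
  simp only [lo_append, lo_cons i _ q, lo_singleton, hi_singleton, hp, hq, hi_append] at hc ⊢
  simp at hc ⊢; omega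

/-- The tensor product rule: the last unpaired `i` of `u v` lies in `v` exactly when `v` has more
unpaired `i` than `u` has unpaired `i + 1` to cancel them. -/
theorem raise_append {i : ℕ} {u v u' v' : List ℕ} (h : Raise i (u ++ v) (u' ++ v'))
    (hl : u.length = u'.length) :
    (Raise i u u' ∧ v = v' ∧ lo i v ≤ hi i u) ∨ (Raise i v v' ∧ u = u' ∧ hi i u < lo i v) := by
  obtain ⟨p, q, h1, h2, hp, hq⟩ := h
  rcases List.append_eq_append_iff.1 h1 with ⟨a, rfl, ha⟩ | ⟨a, rfl, ha⟩
  · right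
    rw [List.append_assoc] at h2
    obtain ⟨rfl, rfl⟩ := List.append_inj h2 hl.symm
    subst ha
    refine ⟨⟨a, q, rfl, rfl, ?_, hq⟩, rfl, ?_⟩ <;> rw [hi_append] at hp
    · omega
    · rw [lo_append, lo_cons, lo_singleton, hi_singleton]; simp; omega
  · rcases a with _ | ⟨c, a⟩
    · simp only [List.nil_append, List.append_nil] at ha hl
      subst ha
      obtain ⟨rfl, rfl⟩ := List.append_inj h2 hl.symm
      right
      refine ⟨⟨[], q, rfl, rfl, rfl, hq⟩, by simp, ?_⟩
      rw [lo_cons, lo_singleton, hi_singleton]; simp; omega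
    · simp only [List.cons_append, List.cons.injEq] at ha
      obtain ⟨rfl, rfl⟩ := ha
      rw [show p ++ (i + 1) :: (a ++ v) = (p ++ (i + 1) :: a) ++ v by simp] at h2
      obtain ⟨rfl, rfl⟩ := List.append_inj h2 (by simp at hl ⊢; omega)
      left
      rw [lo_append] at hq
      refine ⟨⟨p, a, rfl, rfl, hp, by omega⟩, rfl, ?_⟩
      rw [hi_append, hi_cons, hi_singleton]; simp; omega

theorem not_raise_nil {i : ℕ} {w : List ℕ} : ¬ Raise i [] w := by
  rintro ⟨u, v, h, -⟩; simp at h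

theorem raise_singleton {i x x' : ℕ} : Raise i [x] [x'] ↔ x = i ∧ x' = i + 1 := by
  constructor
  · rintro ⟨u, v, h, h', -⟩
    rcases u with _ | ⟨c, u⟩ <;> simp_all
  · rintro ⟨rfl, rfl⟩
    exact ⟨[], [], rfl, rfl, rfl, rfl⟩

/-! ### Sorted words -/

/-- No `i + 1` precedes an `i` in a sorted word, so nothing is paired. -/
theorem hi_of_sorted {i : ℕ} {w : List ℕ} (h : w.Pairwise (· ≤ ·)) : hi i w = w.count (i + 1) := by
  induction w with
  | nil => rfl
  | cons c w ih =>
    rw [List.pairwise_cons] at h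
    rw [hi_cons, hi_singleton, ih h.2, List.count_cons]
    by_cases hc : c = i + 1
    · have : lo i w = 0 := lo_eq_zero fun hm => by have := h.1 _ hm; omega
      simp [hc, this]
    · simp [hc]

theorem lo_of_sorted {i : ℕ} {w : List ℕ} (h : w.Pairwise (· ≤ ·)) : lo i w = w.count i := by
  have := count_signature i w
  rw [hi_of_sorted h] at this
  omega

/-- Raising a sorted word. -/
theorem Raise.split_of_sorted {i : ℕ} {w w' : List ℕ} (h : Raise i w w')
    (hs : w.Pairwise (· ≤ ·) ∨ w'.Pairwise (· ≤ ·)) :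
    ∃ u v, w = u ++ i :: v ∧ w' = u ++ (i + 1) :: v ∧ (∀ a ∈ u, a ≤ i) ∧ (∀ b ∈ v, i + 1 ≤ b) ∧
      u.Pairwise (· ≤ ·) ∧ v.Pairwise (· ≤ ·) := by
  obtain ⟨u, v, rfl, rfl, hu, hv⟩ := h
  simp only [List.pairwise_append, List.pairwise_cons] at hs
  have su : u.Pairwise (· ≤ ·) := by tauto
  have sv : v.Pairwise (· ≤ ·) := by tauto
  rw [hi_of_sorted su, List.count_eq_zero] at hu
  rw [lo_of_sorted sv, List.count_eq_zero] at hv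
  refine ⟨u, v, rfl, rfl, fun a ha => ?_, fun b hb => ?_, su, sv⟩
  · have : a ≤ i ∨ a ≤ i + 1 := by
      rcases hs with hs | hs
      · exact .inl (hs.2.2 a ha i (by simp))
      · exact .inr (hs.2.2 a ha _ (by simp))
    have : a ≠ i + 1 := fun h => hu (h ▸ ha)
    omega
  · have : i ≤ b ∨ i + 1 ≤ b := by
      rcases hs with hs | hs
      · exact .inl (hs.2.1.1 b hb)
      · exact .inr (hs.2.1.1 b hb)
    have : b ≠ i := fun h => hv (h ▸ hb)
    omega

theorem sorted_of_split {i x : ℕ} {u v : List ℕ} (hu : ∀ a ∈ u, a ≤ i) (hv : ∀ b ∈ v, i + 1 ≤ b)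
    (su : u.Pairwise (· ≤ ·)) (sv : v.Pairwise (· ≤ ·)) (hx : i ≤ x) (hx' : x ≤ i + 1) :
    (u ++ x :: v).Pairwise (· ≤ ·) := by
  rw [List.pairwise_append, List.pairwise_cons]
  refine ⟨su, ⟨fun b hb => hx'.trans (hv b hb), sv⟩, fun a ha b hb => ?_⟩
  have := hu a ha
  rcases List.mem_cons.1 hb with rfl | hb
  · omega
  · have := hv b hb; omega

theorem Raise.sorted_iff {i : ℕ} {w w' : List ℕ} (h : Raise i w w') :
    w.Pairwise (· ≤ ·) ↔ w'.Pairwise (· ≤ ·) := by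
  constructor
  · intro hs
    obtain ⟨u, v, rfl, rfl, hu, hv, su, sv⟩ := h.split_of_sorted (.inl hs)
    exact sorted_of_split hu hv su sv (by omega) le_rfl
  · intro hs
    obtain ⟨u, v, rfl, rfl, hu, hv, su, sv⟩ := h.split_of_sorted (.inr hs)
    exact sorted_of_split hu hv su sv le_rfl (by omega)

/-! ### Row insertion in a sorted row -/

theorem insertRow_append {R : List ℕ} {x : ℕ} (h : ∀ a ∈ R, a ≤ x) (S : List ℕ) :
    insertRow (R ++ S) x = (R ++ (insertRow S x).1, (insertRow S x).2) := by
  induction R with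
  | nil => rfl
  | cons a R ih =>
    simp only [List.mem_cons, forall_eq_or_imp] at h
    rw [List.cons_append, insertRow, if_neg (by omega), ih h.2]; rfl

theorem insertRow_bump {P Q : List ℕ} {x y : ℕ} (h : ∀ a ∈ P, a ≤ x) (hy : x < y) :
    insertRow (P ++ y :: Q) x = (P ++ x :: Q, some y) := by
  rw [insertRow_append h, insertRow, if_pos hy]

theorem insertRow_end {R : List ℕ} {x : ℕ} (h : ∀ a ∈ R, a ≤ x) :
    insertRow R x = (R ++ [x], none) := by
  have := insertRow_append h []
  rwa [List.append_nil] at this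

/-- Either `x` is put at the end of the row, or it bumps a letter `y`. -/
theorem insertion_cases (R : List ℕ) (x : ℕ) :
    (∀ a ∈ R, a ≤ x) ∨ ∃ P y Q, R = P ++ y :: Q ∧ (∀ a ∈ P, a ≤ x) ∧ x < y := by
  induction R with
  | nil => simp
  | cons a R ih =>
    by_cases ha : x < a
    · exact .inr ⟨[], a, R, rfl, by simp, ha⟩
    · rcases ih with ih | ⟨P, y, Q, rfl, hP, hy⟩
      · left; simp only [List.mem_cons, forall_eq_or_imp]; exact ⟨by omega, ih⟩
      · refine .inr ⟨a :: P, y, Q, rfl, ?_, hy⟩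
        simp only [List.mem_cons, forall_eq_or_imp]; exact ⟨by omega, hP⟩

theorem insertRow_sorted {R : List ℕ} (hR : R.Pairwise (· ≤ ·)) (x : ℕ) :
    (insertRow R x).1.Pairwise (· ≤ ·) := by
  rcases insertion_cases R x with h | ⟨P, y, Q, rfl, hP, hy⟩
  · rw [insertRow_end h, List.pairwise_append]
    exact ⟨hR, by simp, by simpa using h⟩
  · rw [insertRow_bump hP hy]
    rw [List.pairwise_append, List.pairwise_cons] at hR ⊢
    refine ⟨hR.1, ⟨fun b hb => hy.le.trans (hR.2.1.1 b hb), hR.2.1.2⟩, fun a ha b hb => ?_⟩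
    rcases List.mem_cons.1 hb with rfl | hb
    · exact hP a ha
    · exact hR.2.2 a ha b (List.mem_cons_of_mem _ hb)

/-- The word `y R'` (or `R'`) that is obtained from `R x` by inserting `x` in the row `R`. -/
def bumpWord (p : List ℕ × Option ℕ) : List ℕ := p.2.toList ++ p.1

theorem bumpWord_perm (R : List ℕ) (x : ℕ) : (bumpWord (insertRow R x)).Perm (R ++ [x]) := by
  rcases insertion_cases R x with h | ⟨P, y, Q, rfl, hP, hy⟩
  · rw [insertRow_end h]; exact List.Perm.refl _
  · rw [insertRow_bump hP hy]
    simp only [bumpWord, Option.toList_some, List.append_assoc,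
      List.cons_append]
    rw [List.perm_iff_count]
    intro a
    simp only [List.count_append, List.count_cons, List.count_nil]
    omega

/-- Inserting a letter in a row preserves the number of unpaired letters. -/
theorem hi_bumpWord {R : List ℕ} (hR : R.Pairwise (· ≤ ·)) (i x : ℕ) :
    hi i (bumpWord (insertRow R x)) = hi i (R ++ [x]) := by
  rcases insertion_cases R x with h | ⟨P, y, Q, rfl, hP, hy⟩
  · rw [insertRow_end h]; rfl
  · have hs := insertRow_sorted hR x
    have hR' := hR
    rw [List.pairwise_append, List.pairwise_cons] at hR
    rw [insertRow_bump hP hy] at hs ⊢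
    simp only [bumpWord, Option.toList_some, List.singleton_append]
    dsimp only at hs
    rw [hi_cons, hi_append i (P ++ y :: Q), hi_of_sorted hR', hi_of_sorted hs, lo_of_sorted hs]
    simp only [hi_singleton, lo_singleton, List.count_append, List.count_cons, beq_iff_eq]
    have h1 : i + 1 < y → Q.count (i + 1) = 0 := fun h =>
      List.count_eq_zero.2 fun hm => by have := hR.2.1.1 _ hm; omega
    have h2 : i < y → Q.count i = 0 := fun h =>
      List.count_eq_zero.2 fun hm => by have := hR.2.1.1 _ hm; omega
    have h3 : x < i → P.count i = 0 := fun h =>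
      List.count_eq_zero.2 fun hm => by have := hP _ hm; omega
    have h4 : x < i + 1 → P.count (i + 1) = 0 := fun h =>
      List.count_eq_zero.2 fun hm => by have := hP _ hm; omega
    split_ifs <;> omega

theorem lo_bumpWord {R : List ℕ} (hR : R.Pairwise (· ≤ ·)) (i x : ℕ) :
    lo i (bumpWord (insertRow R x)) = lo i (R ++ [x]) := by
  have h1 := count_signature i (bumpWord (insertRow R x))
  have h2 := count_signature i (R ++ [x])
  rw [(bumpWord_perm R x).count_eq, (bumpWord_perm R x).count_eq, hi_bumpWord hR] at h1
  omega

/-- The relation of `p` and `p'` being the results of insertions of corresponding letters in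
corresponding rows. -/
def RaiseBump (i : ℕ) (p p' : List ℕ × Option ℕ) : Prop :=
  Raise i (bumpWord p) (bumpWord p') ∧ p.1.length = p'.1.length ∧ p.2.isSome = p'.2.isSome

/-- The case in which the raised letter stays in the row. A bumped `i + 1` is excluded because,
placed in front, it would be an unpaired `i + 1` to the left of the raised letter or pair with an
`i`. -/
theorem raiseBump_of_split {i : ℕ} {L H : List ℕ} {o : Option ℕ}
    (hL : ∀ a ∈ L, a ≤ i) (hH : ∀ b ∈ H, i + 1 ≤ b) (ho : o ≠ some (i + 1)) :
    RaiseBump i (L ++ i :: H, o) (L ++ (i + 1) :: H, o) := by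
  refine ⟨⟨o.toList ++ L, H, by simp [bumpWord], by simp [bumpWord], hi_eq_zero ?_, lo_eq_zero ?_⟩,
    by simp, rfl⟩
  · simp only [List.mem_append, Option.mem_toList, not_or]
    exact ⟨ho, fun h => by have := hL _ h; omega⟩
  · exact fun h => by have := hH _ h; omega

/-- Raising operators commute with the insertion of a letter in a sorted row. -/
theorem raiseBump_insertRow {i : ℕ} {R R₁ : List ℕ} {x x₁ : ℕ} (hR : R.Pairwise (· ≤ ·))
    (hl : R.length = R₁.length) (h : Raise i (R ++ [x]) (R₁ ++ [x₁])) :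
    RaiseBump i (insertRow R x) (insertRow R₁ x₁) := by
  rcases raise_append h hl with ⟨hr, hx, hc⟩ | ⟨hr, rfl, hc⟩
  · obtain rfl : x = x₁ := by simpa using hx
    obtain ⟨L, H, rfl, rfl, hL, hH, sL, sH⟩ := hr.split_of_sorted (.inl hR)
    rcases lt_trichotomy x i with hxi | rfl | hxi
    · rcases insertion_cases L x with hb | ⟨P, y, Q, rfl, hP, hy⟩
      -- Here `x` bumps the raised letter itself, so the change moves to the head of the bump word.
      · rw [insertRow_bump hb hxi, insertRow_bump hb (hxi.trans (Nat.lt_succ_self i))]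
        refine ⟨⟨[], L ++ x :: H, by simp [bumpWord], by simp [bumpWord], rfl, lo_eq_zero ?_⟩,
          by simp, rfl⟩
        simp only [List.mem_append, List.mem_cons, not_or]
        exact ⟨fun h => by have := hb _ h; omega, by omega, fun h => by have := hH _ h; omega⟩
      · simp only [List.append_assoc, List.cons_append]
        rw [insertRow_bump hP hy, insertRow_bump hP hy]
        have := hL y (by simp)
        have key := raiseBump_of_split (L := P ++ x :: Q) (o := some y) (i := i) (H := H) ?_ hH
          (by simp; omega)
        · simpa using key
        · intro a ha
          simp only [List.mem_append, List.mem_cons] at ha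
          rcases ha with ha | rfl | ha
          · exact hL a (by simp [ha])
          · omega
          · exact hL a (by simp [ha])
    -- The final `x = i` was not the letter raised, so the row has an `i + 1` pairing with it and
    -- `H` begins with `i + 1`. In `R` this letter is bumped, in `R₁` the raised one; both bumped
    -- letters are `i + 1`, and the change moves one cell to the right.
    · rw [lo_singleton, if_pos rfl, hi_of_sorted hR] at hc
      have h1 : L.count (x + 1) = 0 :=
        List.count_eq_zero.2 fun hm => by have := hL _ hm; omega
      simp only [List.count_append, List.count_cons, h1, beq_iff_eq] at hc
      rcases H with _ | ⟨c, H⟩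
      · simp at hc
      have hcx : c = x + 1 := by
        by_contra hne
        have : (c :: H).count (x + 1) = 0 := by
          refine List.count_eq_zero.2 fun hm => ?_
          rw [List.pairwise_cons] at sH
          have h3 := hH c (by simp)
          rcases List.mem_cons.1 hm with h2 | h2
          · omega
          · have := sH.1 _ h2; omega
        simp only [List.count_cons, beq_iff_eq] at this hc
        split_ifs at * <;> omega
      subst hcx
      rw [show L ++ x :: (x + 1) :: H = (L ++ [x]) ++ (x + 1) :: H by simp,
        insertRow_bump (fun a ha => (List.mem_append.1 ha).elim (hL a) fun h => (List.mem_singleton.1 h).le)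
          (Nat.lt_succ_self x), insertRow_bump hL (Nat.lt_succ_self x)]
      refine ⟨⟨(x + 1) :: (L ++ [x]), H, by simp [bumpWord], by simp [bumpWord], ?_, lo_eq_zero ?_⟩,
        by simp, rfl⟩
      · rw [hi_cons, hi_append, lo_append, hi_singleton, hi_singleton, lo_singleton,
          hi_of_sorted sL, h1]
        simp
      · exact fun h => by have := hH _ (List.mem_cons_of_mem _ h); omega
    · have e : ∀ c, c ≤ i + 1 → insertRow (L ++ c :: H) x =
          (L ++ c :: (insertRow H x).1, (insertRow H x).2) := by
        intro c hc
        have := insertRow_append (R := L ++ [c]) (x := x) (fun a ha => by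
          rcases List.mem_append.1 ha with ha | ha
          · have := hL a ha; omega
          · have := List.mem_singleton.1 ha; omega) H
        simpa using this
      rw [e i (by omega), e (i + 1) le_rfl]
      have hm : ∀ b ∈ (insertRow H x).1, i + 1 ≤ b := by
        intro b hb
        have := (bumpWord_perm H x).mem_iff.1 (List.mem_append_right _ hb)
        rcases List.mem_append.1 this with h | h
        · exact hH b h
        · have := List.mem_singleton.1 h; omega
      refine raiseBump_of_split hL hm ?_
      rcases insertion_cases H x with hb | ⟨P, y, Q, rfl, hP, hy⟩
      · rw [insertRow_end hb]; simp
      · rw [insertRow_bump hP hy]; simp; omega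
  · obtain ⟨rfl, rfl⟩ := raise_singleton.1 hr
    rw [lo_singleton, if_pos rfl, hi_of_sorted hR, Nat.lt_one_iff, List.count_eq_zero] at hc
    rcases insertion_cases R x with hb | ⟨P, y, Q, rfl, hP, hy⟩
    · rw [insertRow_end hb, insertRow_end fun a ha => (hb a ha).trans (Nat.le_succ x)]
      exact raiseBump_of_split hb (by simp) (by simp)
    -- Since the final `x` is unpaired, the row has no `x + 1`; hence `x` and `x + 1` bump the same
    -- letter.
    · have : y ≠ x + 1 := fun h => hc (by simp [h])
      rw [insertRow_bump hP hy, insertRow_bump (fun a ha => (hP a ha).trans (Nat.le_succ x))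
        (by omega)]
      rw [List.pairwise_append, List.pairwise_cons] at hR
      exact raiseBump_of_split hP (fun b hb => by have := hR.2.1.1 b hb; omega) (by simp; omega)

/-! ### Words of fillings and row insertion -/

/-- The row word of a filling: rows are read from left to right and from bottom to top. -/
def word (T : Filling) : List ℕ := T.reverse.flatten

@[simp] theorem word_nil : word [] = [] := rfl

@[simp] theorem word_cons (R : List ℕ) (T : Filling) : word (R :: T) = word T ++ R := by
  simp [word]

@[simp] theorem word_append (S T : Filling) : word (S ++ T) = word T ++ word S := by
  simp [word]

/-- The list of row lengths. -/
def shape (T : Filling) : List ℕ := T.map List.length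

@[simp] theorem shape_nil : shape [] = [] := rfl

@[simp] theorem shape_cons (R : List ℕ) (T : Filling) : shape (R :: T) = R.length :: shape T := rfl

@[simp] theorem shape_append (S T : Filling) : shape (S ++ T) = shape S ++ shape T := by
  simp [shape]

theorem length_word (T : Filling) : (word T).length = (shape T).sum := by
  induction T with
  | nil => rfl
  | cons R T ih => simp [ih, Nat.add_comm]

theorem length_word_eq {T T' : Filling} (h : shape T = shape T') :
    (word T).length = (word T').length := by rw [length_word, length_word, h]

theorem length_eq_of_shape {T T' : Filling} (h : shape T = shape T') : T.length = T'.length := by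
  simpa [shape] using congrArg List.length h

theorem shape_cons_eq {R : List ℕ} {T T' : Filling} (h : shape (R :: T) = shape T') :
    ∃ R' T'', T' = R' :: T'' ∧ R.length = R'.length ∧ shape T = shape T'' := by
  rcases T' with _ | ⟨R', T''⟩
  · simp at h
  · simp only [shape_cons, List.cons.injEq] at h
    exact ⟨R', T'', rfl, h⟩

theorem eq_of_word_eq {T T' : Filling} (h : shape T = shape T') (hw : word T = word T') :
    T = T' := by
  induction T generalizing T' with
  | nil => simpa [shape, eq_comm] using h
  | cons R T ih =>
    obtain ⟨R', T'', rfl, hR, hT⟩ := shape_cons_eq h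
    rw [word_cons, word_cons] at hw
    obtain ⟨h1, rfl⟩ := List.append_inj hw (length_word_eq hT)
    rw [ih hT h1]

/-- Lifts the intermediate words of an iterated raising to fillings of the given shape. -/
theorem exists_word_eq (T : Filling) {w : List ℕ} (h : (word T).length = w.length) :
    ∃ T', shape T = shape T' ∧ word T' = w := by
  induction T generalizing w with
  | nil => exact ⟨[], rfl, by simpa [eq_comm] using h⟩
  | cons R T ih =>
    rw [word_cons, List.length_append] at h
    obtain ⟨T', h1, h2⟩ := ih (w := w.take (word T).length) (by simp; omega)
    refine ⟨w.drop (word T).length :: T', ?_, ?_⟩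
    · simp [h1]; omega
    · rw [word_cons, h2, List.take_append_drop]

/-- All rows increase weakly. -/
def RowSorted (T : Filling) : Prop := ∀ R ∈ T, R.Pairwise (· ≤ ·)

theorem rowSorted_cons {R : List ℕ} {T : Filling} :
    RowSorted (R :: T) ↔ R.Pairwise (· ≤ ·) ∧ RowSorted T := by
  simp [RowSorted]

theorem Raise.rowSorted_iff {i : ℕ} {T T' : Filling} (hs : shape T = shape T')
    (h : Raise i (word T) (word T')) : RowSorted T ↔ RowSorted T' := by
  induction T generalizing T' with
  | nil => exact absurd h not_raise_nil
  | cons R T ih =>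
    obtain ⟨R', T', rfl, hR, hT⟩ := shape_cons_eq hs
    rw [word_cons, word_cons] at h
    rw [rowSorted_cons, rowSorted_cons]
    rcases raise_append h (length_word_eq hT) with ⟨hr, rfl, -⟩ | ⟨hr, e, -⟩
    · rw [ih hT hr]
    · rw [eq_of_word_eq hT e, hr.sorted_iff]

theorem rowInsert_sorted {T : Filling} (hT : RowSorted T) (x : ℕ) : RowSorted (rowInsert T x) := by
  induction T generalizing x with
  | nil => simp [RowSorted, rowInsert]
  | cons R T ih =>
    rw [rowSorted_cons] at hT
    have := insertRow_sorted hT.1 x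
    rw [rowInsert]
    rcases he : insertRow R x with ⟨R', _ | y⟩ <;> rw [he] at this
    · exact rowSorted_cons.2 ⟨this, hT.2⟩
    · exact rowSorted_cons.2 ⟨this, ih hT.2 y⟩

theorem signature_rowInsert {T : Filling} (hT : RowSorted T) (i x : ℕ) :
    lo i (word (rowInsert T x)) = lo i (word T ++ [x]) ∧
      hi i (word (rowInsert T x)) = hi i (word T ++ [x]) := by
  induction T generalizing x with
  | nil => simp [rowInsert]
  | cons R T ih =>
    rw [rowSorted_cons] at hT
    have h1 := lo_bumpWord hT.1 i x
    have h2 := hi_bumpWord hT.1 i x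
    rw [rowInsert, word_cons, List.append_assoc]
    rcases he : insertRow R x with ⟨R', _ | y⟩ <;>
      simp only [he, bumpWord, Option.toList_none, Option.toList_some, List.nil_append,
        word_cons] at h1 h2 ⊢
    · rw [lo_append, hi_append, lo_append i _ (R ++ [x]), hi_append i _ (R ++ [x]), h1, h2]
      exact ⟨rfl, rfl⟩
    · obtain ⟨h3, h4⟩ := ih hT.2 y
      rw [lo_append, hi_append, h3, h4, ← lo_append, ← hi_append, List.append_assoc,
        lo_append, hi_append, lo_append i _ (R ++ [x]), hi_append i _ (R ++ [x]), h1, h2]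
      exact ⟨rfl, rfl⟩

/-- Raising operators commute with row insertion. -/
theorem raise_rowInsert {i x x' : ℕ} {T T' : Filling} (hT : RowSorted T)
    (hs : shape T = shape T') (h : Raise i (word T ++ [x]) (word T' ++ [x'])) :
    Raise i (word (rowInsert T x)) (word (rowInsert T' x')) ∧
      shape (rowInsert T x) = shape (rowInsert T' x') := by
  induction T generalizing T' x x' with
  | nil =>
    obtain rfl : T' = [] := by simpa [shape, eq_comm] using hs
    simpa [rowInsert] using h
  | cons R T ih =>
    obtain ⟨R', T', rfl, hR, hT'⟩ := shape_cons_eq hs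
    rw [rowSorted_cons] at hT
    have h1 := lo_bumpWord hT.1 i x
    have h2 := hi_bumpWord hT.1 i x
    rw [word_cons, word_cons, List.append_assoc, List.append_assoc] at h
    rcases raise_append h (length_word_eq hT') with ⟨hr, e, hc⟩ | ⟨hr, e, hc⟩
    · obtain ⟨rfl, e⟩ := List.append_inj e hR
      obtain rfl : x = x' := by simpa using e
      rw [rowInsert, rowInsert]
      rcases he : insertRow R x with ⟨S, _ | y⟩ <;>
        simp only [he, bumpWord, Option.toList_none, Option.toList_some, List.nil_append,
          word_cons] at h1 h2 ⊢
      · exact ⟨hr.append_right (by omega), by simp [hT']⟩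
      · have h3 := hr.append_right (v := [y] ++ S) (by omega)
        rw [← List.append_assoc, ← List.append_assoc] at h3
        rcases raise_append h3 (by simp [length_word_eq hT']) with ⟨h4, -, hc⟩ | ⟨h4, e, hc⟩
        · obtain ⟨h5, h6⟩ := ih hT.2 hT' h4
          refine ⟨h5.append_right ?_, by simp [h6]⟩
          rwa [(signature_rowInsert hT.2 i y).2]
        -- A raise changes the signature, so the words of `T` and `T'` cannot agree.
        · have := hr.signature
          rw [List.append_cancel_right e] at this
          omega
    · have := eq_of_word_eq hT' e
      subst this
      obtain ⟨h3, h4, h5⟩ := raiseBump_insertRow hT.1 hR hr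
      rw [rowInsert, rowInsert]
      rcases he : insertRow R x with ⟨S, _ | y⟩ <;>
        rcases he' : insertRow R' x' with ⟨S', _ | y'⟩ <;>
          simp only [he, he', bumpWord, Option.toList_none, Option.toList_some, List.nil_append,
            word_cons, Option.isSome, reduceCtorEq] at h1 h2 h3 h4 h5 ⊢
      · exact ⟨h3.append_left (by omega), by simp [h4]⟩
      -- The raise inside `y S` is viewed in `(T y) S`: it either enters `T y`, where the induction
      -- hypothesis applies, or stays in the new row.
      · have h6 := h3.append_left (u := word T) (by omega)
        rw [← List.append_assoc, ← List.append_assoc] at h6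
        rcases raise_append h6 (by simp) with ⟨h7, rfl, hc⟩ | ⟨h7, e, hc⟩
        · obtain ⟨h8, h9⟩ := ih hT.2 rfl h7
          refine ⟨h8.append_right ?_, by simp [h9]⟩
          rwa [(signature_rowInsert hT.2 i y).2]
        · obtain rfl : y = y' := by simpa using e
          refine ⟨h7.append_left ?_, by simp [h4]⟩
          rwa [(signature_rowInsert hT.2 i y).2]

/-! ### Iterated raising, reflections and rotations of words -/

/-- `w'` arises from `w` by `k` raising steps. -/
def RaiseIter (i : ℕ) : ℕ → List ℕ → List ℕ → Prop
  | 0, w, w' => w = w'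
  | k + 1, w, w' => ∃ v, RaiseIter i k w v ∧ Raise i v w'

theorem RaiseIter.signature {i k : ℕ} {w w' : List ℕ} (h : RaiseIter i k w w') :
    lo i w = lo i w' + k ∧ hi i w' = hi i w + k := by
  induction k generalizing w' with
  | zero => obtain rfl : w = w' := h; simp
  | succ k ih =>
    obtain ⟨v, h1, h2⟩ := h
    have := ih h1
    have := h2.signature
    omega

theorem RaiseIter.length_eq {i k : ℕ} {w w' : List ℕ} (h : RaiseIter i k w w') :
    w.length = w'.length := by
  induction k generalizing w' with
  | zero => obtain rfl : w = w' := h; rfl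
  | succ k ih =>
    obtain ⟨v, h1, h2⟩ := h
    rw [ih h1, h2.length_eq]

theorem RaiseIter.head {i k : ℕ} {w v w' : List ℕ} (h : Raise i w v) (h' : RaiseIter i k v w') :
    RaiseIter i (k + 1) w w' := by
  induction k generalizing w' with
  | zero => obtain rfl : v = w' := h'; exact ⟨w, rfl, h⟩
  | succ k ih =>
    obtain ⟨v', h1, h2⟩ := h'
    exact ⟨v', ih h1, h2⟩

/-- Each step increases `hi i u`, so the tensor product rule keeps selecting the left factor. -/
theorem RaiseIter.append_right {i k : ℕ} {u u' v : List ℕ} (h : RaiseIter i k u u')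
    (hc : lo i v ≤ hi i u) : RaiseIter i k (u ++ v) (u' ++ v) := by
  induction k generalizing u' with
  | zero => obtain rfl : u = u' := h; rfl
  | succ k ih =>
    obtain ⟨w, h1, h2⟩ := h
    have := h1.signature
    exact ⟨w ++ v, ih h1, h2.append_right (by omega)⟩

/-- By the bound, `u` still offers an `i` not cancelled by `x` at each of the `k` steps, so `x` is
never reached. -/
theorem RaiseIter.of_cons {i k x x' : ℕ} {u u' : List ℕ} (h : RaiseIter i k (x :: u) (x' :: u'))
    (hc : k + hi i [x] ≤ lo i u) : x = x' ∧ RaiseIter i k u u' := by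
  induction k generalizing x' u' with
  | zero =>
    obtain ⟨rfl, rfl⟩ := List.cons.inj h
    exact ⟨rfl, rfl⟩
  | succ k ih =>
    obtain ⟨v, h1, h2⟩ := h
    rcases v with _ | ⟨y, v⟩
    · exact absurd h2 not_raise_nil
    · obtain ⟨rfl, h3⟩ := ih h1 (by omega)
      have := h3.signature
      rcases raise_append (u := [x]) (u' := [x']) h2 rfl with ⟨-, -, h5⟩ | ⟨h4, e, -⟩
      · omega
      · exact ⟨by simpa using e, v, h3, h4⟩

/-- The exponent `lo - hi` is essential. With it, either all steps take place in `u` both before and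
after the rotation, or `x` is raised in both cases (or `k = 0`). -/
theorem RaiseIter.rotate {i k x x' : ℕ} {u u' : List ℕ} (h : RaiseIter i k (x :: u) (x' :: u'))
    (hk : lo i (x :: u) = hi i (x :: u) + k) : RaiseIter i k (u ++ [x]) (u' ++ [x']) := by
  rw [lo_cons i x u, hi_cons i x u] at hk
  have key : k + hi i [x] ≤ lo i u → lo i [x] ≤ hi i u →
      RaiseIter i k (u ++ [x]) (u' ++ [x']) := by
    intro h1 h2
    obtain ⟨rfl, h3⟩ := h.of_cons h1
    exact h3.append_right h2
  rw [lo_singleton, hi_singleton] at hk key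
  by_cases h1 : x = i + 1
  · simp only [if_pos h1, if_neg (show ¬ x = i by omega)] at hk key
    rcases Nat.eq_zero_or_pos k with rfl | hk0
    · obtain ⟨rfl, rfl⟩ := List.cons.inj h
      rfl
    · exact key (by omega) (by omega)
  · rw [if_neg h1] at hk key
    by_cases h2 : x = i
    · rw [if_pos h2] at hk key
      by_cases h3 : hi i u = 0
      · obtain rfl : k = lo i u + 1 := by omega
        obtain ⟨v, h4, h5⟩ := h
        rcases v with _ | ⟨y, v⟩
        · exact absurd h5 not_raise_nil
        · obtain ⟨rfl, h6⟩ := h4.of_cons (by rw [hi_singleton, if_neg h1]; omega)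
          have h7 := h6.signature
          rcases raise_append (u := [x]) (u' := [x']) h5 rfl with ⟨h8, rfl, -⟩ | ⟨-, -, h9⟩
          -- Before the rotation `x = i` is raised last, after `lo i u` steps in `u`; at the right
          -- end of the word it is raised first.
          · refine RaiseIter.head (v := u ++ [x']) (Raise.append_left h8 ?_)
              (h6.append_right ?_)
            · rw [lo_singleton, if_pos h2]; omega
            · obtain ⟨-, rfl⟩ := raise_singleton.1 h8
              rw [lo_singleton, if_neg (by omega)]; omega
          · omega
      · exact key (by omega) (by omega)
    · rw [if_neg h2] at hk key
      exact key (by omega) (by omega)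

theorem raiseIter_rowInsert {i k x x' : ℕ} {T T' : Filling}
    (hT' : RowSorted T') (hs : shape T = shape T')
    (h : RaiseIter i k (word T ++ [x]) (word T' ++ [x'])) :
    RaiseIter i k (word (rowInsert T x)) (word (rowInsert T' x')) ∧
      shape (rowInsert T x) = shape (rowInsert T' x') := by
  induction k generalizing x' T' with
  | zero =>
    have h : word T ++ [x] = word T' ++ [x'] := h
    obtain ⟨h1, h2⟩ := List.append_inj h (length_word_eq hs)
    obtain rfl := eq_of_word_eq hs h1
    obtain rfl : x = x' := by simpa using h2
    exact ⟨rfl, rfl⟩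
  | succ k ih =>
    obtain ⟨v, h1, h2⟩ := h
    -- The letter to be inserted is treated as an extra top row, which makes `word T' ++ [x']` the
    -- word of a filling.
    obtain ⟨S, h3, rfl⟩ := exists_word_eq ([x'] :: T') (w := v)
      (by rw [word_cons, h2.length_eq])
    obtain ⟨R, S, rfl, h4, h5⟩ := shape_cons_eq h3
    obtain ⟨y, rfl⟩ := List.length_eq_one_iff.1 h4.symm
    have h6 : RowSorted ([y] :: S) := (Raise.rowSorted_iff (T' := [x'] :: T') h3.symm
      (by rwa [word_cons [x']])).2 (rowSorted_cons.2 ⟨by simp, hT'⟩)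
    rw [rowSorted_cons] at h6
    rw [word_cons] at h1 h2
    obtain ⟨h7, h8⟩ := ih h6.2 (hs.trans h5) h1
    obtain ⟨h9, h10⟩ := raise_rowInsert h6.2 h5.symm h2
    exact ⟨⟨_, h7, h9⟩, h8.trans h10⟩

/-- `w'` is the image of `w` under the Kashiwara action of `s_i`. -/
def Reflects (i : ℕ) (w w' : List ℕ) : Prop :=
  (∃ k, RaiseIter i k w w' ∧ lo i w = hi i w + k) ∨
    ∃ k, RaiseIter i k w' w ∧ lo i w' = hi i w' + k

/-- The Kashiwara action commutes with rotations of words. -/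
theorem Reflects.rotate {i x x' : ℕ} {u u' : List ℕ} (h : Reflects i (x :: u) (x' :: u')) :
    Reflects i (u ++ [x]) (u' ++ [x']) := by
  have key : ∀ {x : ℕ} {u : List ℕ} {k : ℕ}, lo i (x :: u) = hi i (x :: u) + k →
      lo i (u ++ [x]) = hi i (u ++ [x]) + k := by
    intro x u k h
    have h1 := count_signature i (x :: u)
    have h2 := count_signature i (u ++ [x])
    have e : (u ++ [x]).Perm (x :: u) := List.perm_append_singleton x u
    rw [e.count_eq, e.count_eq] at h2
    omega
  rcases h with ⟨k, h, hk⟩ | ⟨k, h, hk⟩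
  · exact .inl ⟨k, h.rotate hk, key hk⟩
  · exact .inr ⟨k, h.rotate hk, key hk⟩

theorem reflects_rowInsert {i x x' : ℕ} {T T' : Filling} (hT : RowSorted T)
    (hT' : RowSorted T') (hs : shape T = shape T')
    (h : Reflects i (word T ++ [x]) (word T' ++ [x'])) :
    Reflects i (word (rowInsert T x)) (word (rowInsert T' x')) ∧
      shape (rowInsert T x) = shape (rowInsert T' x') := by
  have key : ∀ {T : Filling} {x k : ℕ}, RowSorted T →
      lo i (word T ++ [x]) = hi i (word T ++ [x]) + k →
      lo i (word (rowInsert T x)) = hi i (word (rowInsert T x)) + k := by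
    intro T x k hT h
    rwa [(signature_rowInsert hT i x).1, (signature_rowInsert hT i x).2]
  rcases h with ⟨k, h, hk⟩ | ⟨k, h, hk⟩
  · obtain ⟨h1, h2⟩ := raiseIter_rowInsert hT' hs h
    exact ⟨.inl ⟨k, h1, key hT hk⟩, h2⟩
  · obtain ⟨h1, h2⟩ := raiseIter_rowInsert hT hs.symm h
    exact ⟨.inr ⟨k, h1, key hT' hk⟩, h2.symm⟩

/-! ### Cyclage -/

/-- Removal of the first letter of the bottom row, where `R` is the rest of this row. -/
def stripped (C : Filling) (R : List ℕ) : Filling := if R = [] then C else C ++ [R]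

theorem cyclage_eq (C : Filling) (x : ℕ) (R : List ℕ) :
    cyclage (C ++ [x :: R]) = rowInsert (stripped C R) x := by
  simp [cyclage, stripped]

theorem cyclage_of_empty_row (C : Filling) : cyclage (C ++ [[]]) = C ++ [[]] := by
  simp [cyclage]

theorem word_stripped (C : Filling) (R : List ℕ) : word (stripped C R) = R ++ word C := by
  unfold stripped
  split_ifs with h <;> simp [h]

theorem shape_stripped {C C' : Filling} {R R' : List ℕ} (h : shape C = shape C')
    (hR : R.length = R'.length) : shape (stripped C R) = shape (stripped C' R') := by
  unfold stripped
  have : R = [] ↔ R' = [] := by rw [← List.length_eq_zero_iff, hR, List.length_eq_zero_iff]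
  simp only [this]
  split_ifs <;> simp [h, hR]

theorem rowSorted_stripped {C : Filling} {x : ℕ} {R : List ℕ} (h : RowSorted (C ++ [x :: R])) :
    RowSorted (stripped C R) := by
  intro S hS
  unfold stripped at hS
  have hR := h (x :: R) (by simp)
  split_ifs at hS
  · exact h S (by simp [hS])
  · rcases List.mem_append.1 hS with hS | hS
    · exact h S (by simp [hS])
    · rw [List.mem_singleton.1 hS]
      exact (List.pairwise_cons.1 hR).2

theorem filling_cases (T : Filling) :
    T = [] ∨ (∃ C, T = C ++ [[]]) ∨ ∃ C x R, T = C ++ [x :: R] := by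
  rcases List.eq_nil_or_concat T with h | ⟨C, R, h⟩
  · exact .inl h
  · rcases R with _ | ⟨x, R⟩
    · exact .inr (.inl ⟨C, by simpa using h⟩)
    · exact .inr (.inr ⟨C, x, R, by simpa using h⟩)

theorem cyclage_sorted {T : Filling} (h : RowSorted T) : RowSorted (cyclage T) := by
  rcases filling_cases T with rfl | ⟨C, rfl⟩ | ⟨C, x, R, rfl⟩
  · exact h
  · rwa [cyclage_of_empty_row]
  · rw [cyclage_eq]
    exact rowInsert_sorted (rowSorted_stripped h) x

theorem shape_append_singleton {C T' : Filling} {R : List ℕ} (h : shape (C ++ [R]) = shape T') :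
    ∃ C' R', T' = C' ++ [R'] ∧ shape C = shape C' ∧ R.length = R'.length := by
  rcases List.eq_nil_or_concat T' with rfl | ⟨C', R', rfl⟩
  · simp at h
  · rw [List.concat_eq_append, shape_append, shape_append] at h
    obtain ⟨h1, h2⟩ := List.append_inj' h rfl
    exact ⟨C', R', by simp, h1, by simpa using h2⟩

/-- Fillings of the same shape whose words are related by `s_i` have cyclages with the same
property. -/
theorem reflects_cyclage {i : ℕ} {T T' : Filling} (hT : RowSorted T) (hT' : RowSorted T')
    (hs : shape T = shape T') (h : Reflects i (word T) (word T')) :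
    Reflects i (word (cyclage T)) (word (cyclage T')) ∧
      shape (cyclage T) = shape (cyclage T') := by
  rcases filling_cases T with rfl | ⟨C, rfl⟩ | ⟨C, x, R, rfl⟩
  · obtain rfl : T' = [] := by simpa [shape, eq_comm] using hs
    exact ⟨h, rfl⟩
  · obtain ⟨C', R', rfl, h1, h2⟩ := shape_append_singleton hs
    obtain rfl : R' = [] := List.length_eq_zero_iff.1 h2.symm
    rw [cyclage_of_empty_row, cyclage_of_empty_row]
    exact ⟨h, hs⟩
  · obtain ⟨C', R', rfl, h1, h2⟩ := shape_append_singleton hs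
    rcases R' with _ | ⟨x', R'⟩
    · simp at h2
    · rw [cyclage_eq, cyclage_eq]
      refine reflects_rowInsert (rowSorted_stripped hT) (rowSorted_stripped hT')
        (shape_stripped h1 (by simpa using h2)) ?_
      rw [word_stripped, word_stripped]
      exact Reflects.rotate (by simpa using h)

/-- Agreement up to the first success suffices, which matters for `f̃_1`, whose commutation with the
cyclage needs two rows. If there is no success, both sets are empty, so termination need not be
shown. -/
theorem sInf_eq_of_agree {p q : ℕ → Prop} (h : ∀ k, (∀ j < k, ¬ p j) → (p k ↔ q k)) :
    sInf {k | p k} = sInf {k | q k} := by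
  classical
  have hq : ∀ k, (∀ j < k, ¬ p j) ↔ ∀ j < k, ¬ q j := by
    intro k
    induction k with
    | zero => simp
    | succ k ih =>
      simp only [Nat.lt_succ_iff_lt_or_eq, or_imp, forall_and, forall_eq]
      constructor
      · rintro ⟨h1, h2⟩; exact ⟨ih.1 h1, fun h3 => h2 ((h k h1).2 h3)⟩
      · rintro ⟨h1, h2⟩; exact ⟨ih.2 h1, fun h3 => h2 ((h k (ih.2 h1)).1 h3)⟩
  by_cases hp : ∃ k, p k
  · have h1 : p (Nat.find hp) := Nat.find_spec hp
    have h2 : ∀ j < Nat.find hp, ¬ p j := fun j hj => Nat.find_min hp hj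
    rw [Nat.sInf_def (s := {k | p k}) hp]
    have h3 : q (Nat.find hp) := (h _ h2).1 h1
    have hq' : ∃ k, q k := ⟨_, h3⟩
    rw [Nat.sInf_def (s := {k | q k}) hq']
    exact ((Nat.find_eq_iff hq').2 ⟨h3, fun j hj => (hq _).1 h2 j hj⟩).symm
  · have hp' : ∀ k, ¬ p k := not_exists.1 hp
    congr 1
    ext k
    exact h k fun j _ => hp' j

/-- The Kashiwara action preserves the cocharge. -/
theorem cocharge_eq_of_reflects {i : ℕ} {T T' : Filling} (hT : RowSorted T) (hT' : RowSorted T')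
    (hs : shape T = shape T') (h : Reflects i (word T) (word T')) :
    cocharge T = cocharge T' := by
  have key : ∀ k, RowSorted (cyclage^[k] T) ∧ RowSorted (cyclage^[k] T') ∧
      shape (cyclage^[k] T) = shape (cyclage^[k] T') ∧
      Reflects i (word (cyclage^[k] T)) (word (cyclage^[k] T')) := by
    intro k
    induction k with
    | zero => exact ⟨hT, hT', hs, h⟩
    | succ k ih =>
      obtain ⟨h1, h2, h3, h4⟩ := ih
      rw [Function.iterate_succ_apply', Function.iterate_succ_apply']
      obtain ⟨h5, h6⟩ := reflects_cyclage h1 h2 h3 h4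
      exact ⟨cyclage_sorted h1, cyclage_sorted h2, h6, h5⟩
  exact sInf_eq_of_agree fun k _ => by rw [length_eq_of_shape (key k).2.2.1]

/-! ### The first raising operator -/

/-- All letters are positive, and those below the first row are at least `2`. -/
def OnesOnTop (T : Filling) : Prop := (∀ x ∈ T.flatten, 1 ≤ x) ∧ ∀ x ∈ T.tail.flatten, 2 ≤ x

theorem rowInsert_ge {m : ℕ} {T : Filling} (h : ∀ y ∈ T.flatten, m ≤ y) {x : ℕ} (hx : m ≤ x) :
    ∀ y ∈ (rowInsert T x).flatten, m ≤ y := by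
  induction T generalizing x with
  | nil => simpa [rowInsert] using hx
  | cons R T ih =>
    have hp := bumpWord_perm R x
    have hm : ∀ y ∈ bumpWord (insertRow R x), m ≤ y := by
      intro y hy
      rcases List.mem_append.1 (hp.mem_iff.1 hy) with hy | hy
      · exact h y (by simp [hy])
      · rwa [List.mem_singleton.1 hy]
    have hT : ∀ y ∈ T.flatten, m ≤ y := fun y hy => h y (by
      rw [List.flatten_cons]; exact List.mem_append_right _ hy)
    rw [rowInsert]
    rcases he : insertRow R x with ⟨S, _ | y⟩ <;> rw [he] at hm <;> intro z hz <;>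
      rcases List.mem_append.1 (List.flatten_cons ▸ hz) with hz | hz
    · exact hm z (List.mem_append_right _ hz)
    · exact hT z hz
    · exact hm z (List.mem_append_right _ hz)
    · exact ih hT (hm y (by simp [bumpWord])) z hz

/-- A letter bumped out of the first row exceeds `x ≥ 1`. -/
theorem onesOnTop_rowInsert {T : Filling} (h : OnesOnTop T) {x : ℕ} (hx : 1 ≤ x) :
    OnesOnTop (rowInsert T x) := by
  refine ⟨rowInsert_ge h.1 hx, ?_⟩
  rcases T with _ | ⟨R, T⟩
  · simp [rowInsert]
  · rw [rowInsert]
    have h2 := h.2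
    rw [List.tail_cons] at h2
    rcases insertion_cases R x with hb | ⟨P, y, Q, rfl, hP, hy⟩
    · rw [insertRow_end hb]; exact h2
    · rw [insertRow_bump hP hy]
      exact rowInsert_ge h2 (by omega)

theorem OnesOnTop.two_le {C : Filling} {x : ℕ} {R : List ℕ} (h : OnesOnTop (C ++ [x :: R]))
    (hC : C ≠ []) : 2 ≤ x := by
  refine h.2 x ?_
  rw [List.tail_append_of_ne_nil hC]
  simp

theorem onesOnTop_stripped {C : Filling} {x : ℕ} {R : List ℕ} (h : OnesOnTop (C ++ [x :: R]))
    (hC : C ≠ []) : OnesOnTop (stripped C R) := by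
  obtain ⟨h1, h2⟩ := h
  rw [List.tail_append_of_ne_nil hC] at h2
  simp only [List.flatten_append, List.mem_append] at h1 h2
  unfold stripped
  split_ifs with hR
  · exact ⟨fun y hy => h1 y (.inl hy), fun y hy => h2 y (.inl hy)⟩
  · refine ⟨fun y hy => h1 y ?_, fun y hy => h2 y ?_⟩
    · simp only [List.flatten_append, List.mem_append] at hy
      exact hy.imp_right fun h => by simp at h ⊢; exact .inr h
    · rw [List.tail_append_of_ne_nil hC] at hy
      simp only [List.flatten_append, List.mem_append] at hy
      exact hy.imp_right fun h => by simp at h ⊢; exact .inr h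

/-- `f̃_1` commutes with the cyclage of fillings with at least two rows. -/
theorem raise_one_cyclage {T T' : Filling} (hT : RowSorted T) (hl : 1 < T.length)
    (h1 : OnesOnTop T) (hs : shape T = shape T') (h : Raise 1 (word T) (word T')) :
    Raise 1 (word (cyclage T)) (word (cyclage T')) ∧ shape (cyclage T) = shape (cyclage T') ∧
      OnesOnTop (cyclage T) := by
  rcases filling_cases T with rfl | ⟨C, rfl⟩ | ⟨C, x, R, rfl⟩
  · simp at hl
  · obtain ⟨C', R', rfl, h3, h2⟩ := shape_append_singleton hs
    obtain rfl : R' = [] := List.length_eq_zero_iff.1 h2.symm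
    rw [cyclage_of_empty_row, cyclage_of_empty_row]
    exact ⟨h, hs, h1⟩
  · obtain ⟨C', R', rfl, h3, h2⟩ := shape_append_singleton hs
    have hC : C ≠ [] := by rintro rfl; simp at hl
    have hx := h1.two_le hC
    rcases R' with _ | ⟨x', R'⟩
    · simp at h2
    · rw [cyclage_eq, cyclage_eq]
      have h4 : Raise 1 ([x] ++ (R ++ word C)) ([x'] ++ (R' ++ word C')) := by simpa using h
      have h5 : Raise 1 (word (stripped C R) ++ [x]) (word (stripped C' R') ++ [x']) := by
        rw [word_stripped, word_stripped]
        -- As `x ≥ 2`, the raised `1` lies in the rest of the word; moved to the right end, `x`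
        -- cancels nothing.
        rcases raise_append h4 rfl with ⟨h6, -⟩ | ⟨h6, e, -⟩
        · have := (raise_singleton.1 h6).1
          omega
        · obtain rfl : x = x' := by simpa using e
          exact h6.append_right (by rw [lo_singleton, if_neg (by omega)]; omega)
      obtain ⟨h6, h7⟩ := raise_rowInsert (rowSorted_stripped hT)
        (shape_stripped h3 (by simpa using h2)) h5
      exact ⟨h6, h7, onesOnTop_rowInsert (onesOnTop_stripped h1 hC) (by omega)⟩

/-- `f̃_1` preserves the cocharge. -/
theorem cocharge_eq_of_raise_one {T T' : Filling} (hT : RowSorted T) (h1 : OnesOnTop T)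
    (hs : shape T = shape T') (h : Raise 1 (word T) (word T')) : cocharge T = cocharge T' := by
  have key : ∀ k, (∀ j < k, ¬ (cyclage^[j] T).length ≤ 1) → RowSorted (cyclage^[k] T) ∧
      OnesOnTop (cyclage^[k] T) ∧ shape (cyclage^[k] T) = shape (cyclage^[k] T') ∧
      Raise 1 (word (cyclage^[k] T)) (word (cyclage^[k] T')) := by
    intro k hk
    induction k with
    | zero => exact ⟨hT, h1, hs, h⟩
    | succ k ih =>
      obtain ⟨h2, h3, h4, h5⟩ := ih fun j hj => hk j (by omega)
      rw [Function.iterate_succ_apply', Function.iterate_succ_apply']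
      obtain ⟨h6, h7, h8⟩ := raise_one_cyclage h2 (not_le.1 (hk k (by omega))) h3 h4 h5
      exact ⟨cyclage_sorted h2, h8, h7, h6⟩
  exact sInf_eq_of_agree fun k hk => by rw [length_eq_of_shape (key k hk).2.2.1]

/-! ### Column strictness -/

/-- Every letter of the row `S` exceeds the letter of the row `R` above it, in terms of the numbers
of small letters. -/
def Dominates (R S : List ℕ) : Prop := ∀ k, S.countP (· ≤ k + 1) ≤ R.countP (· ≤ k)

/-- Semistandardness, in a form that is convenient for crystal operators. -/
def IsTableau (T : Filling) : Prop :=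
  RowSorted T ∧ T.IsChain Dominates ∧ 0 ∉ T.flatten

theorem countP_le_succ (w : List ℕ) (k : ℕ) :
    w.countP (· ≤ k + 1) = w.countP (· ≤ k) + w.count (k + 1) := by
  induction w with
  | nil => rfl
  | cons c w ih =>
    simp only [List.countP_cons, List.count_cons, ih, decide_eq_true_eq, beq_iff_eq]
    split_ifs <;> omega

theorem Raise.countP {i : ℕ} {w w' : List ℕ} (h : Raise i w w') (k : ℕ) :
    w.countP (· ≤ k) = w'.countP (· ≤ k) + if k = i then 1 else 0 := by
  obtain ⟨u, v, rfl, rfl, -⟩ := h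
  simp only [List.countP_append, List.countP_cons, decide_eq_true_eq]
  split_ifs <;> omega

/-- Only the inequality at level `i` is at risk. It follows from the one at level `i - 1` and the
strict bound `hc`, whence `1 ≤ i`. -/
theorem Raise.dominates_upper {i : ℕ} (hi : 1 ≤ i) {R R' S : List ℕ} (h : Raise i R R')
    (hc : S.count (i + 1) < R.count i) : Dominates R S ↔ Dominates R' S := by
  obtain ⟨j, rfl⟩ : ∃ j, i = j + 1 := ⟨i - 1, by omega⟩
  refine ⟨fun hd k => ?_, fun hd k => (hd k).trans (by rw [h.countP]; omega)⟩
  have h1 := hd k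
  rw [h.countP k] at h1
  split_ifs at h1 with hk
  · have h2 := hd j
    have h3 := h.countP (j + 1)
    rw [if_pos rfl, countP_le_succ R] at h3
    rw [hk, countP_le_succ S]
    omega
  · exact h1

theorem Raise.dominates_lower {i : ℕ} {R S S' : List ℕ} (h : Raise i S S')
    (hc : R.count i ≤ S.count (i + 1)) : Dominates R S ↔ Dominates R S' := by
  refine ⟨fun hd k => le_trans (by rw [h.countP]; omega) (hd k), fun hd k => ?_⟩
  have h1 := hd k
  rw [h.countP (k + 1)]
  split_ifs with hk
  · have h2 := hd (k + 1)
    have h3 := h.count (i + 1)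
    rw [if_neg (by omega), if_pos rfl] at h3
    rw [countP_le_succ S', countP_le_succ R, hk] at h2
    rw [← hk] at hc h3 h2
    omega
  · exact h1

/-- The tensor product rule supplies exactly the count inequalities between adjacent rows that keep
columns strict, as signatures of sorted rows are counts. -/
theorem Raise.isChain_iff {i : ℕ} (hi1 : 1 ≤ i) {T T' : Filling} (hT : RowSorted T)
    (hs : shape T = shape T') (h : Raise i (word T) (word T')) :
    T.IsChain Dominates ↔ T'.IsChain Dominates := by
  induction T generalizing T' with
  | nil => exact absurd h not_raise_nil
  | cons R T ih =>
    obtain ⟨R', T', rfl, hR, hT'⟩ := shape_cons_eq hs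
    rw [rowSorted_cons] at hT
    rw [word_cons, word_cons] at h
    rcases raise_append h (length_word_eq hT') with ⟨hr, rfl, hc⟩ | ⟨hr, e, hc⟩
    · have ih := ih hT.2 hT' hr
      rcases T with _ | ⟨S, T⟩
      · exact absurd hr not_raise_nil
      · obtain ⟨S', T', rfl, hS, hT''⟩ := shape_cons_eq hT'
        rw [List.isChain_cons_cons, List.isChain_cons_cons, ih]
        refine and_congr_left fun _ => ?_
        rw [rowSorted_cons] at hT
        rw [word_cons] at hr hc
        rw [word_cons] at hr
        rcases raise_append hr (length_word_eq hT'') with ⟨hr', rfl, hc'⟩ | ⟨hr', e, hc'⟩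
        · rfl
        · refine hr'.dominates_lower ?_
          rw [hi_append, lo_of_sorted hT.1, hi_of_sorted hT.2.1] at hc
          omega
    · obtain rfl := eq_of_word_eq hT' e
      rcases T with _ | ⟨S, T⟩
      · simp
      · rw [List.isChain_cons_cons, List.isChain_cons_cons]
        refine and_congr_left fun _ => hr.dominates_upper hi1 ?_
        rw [rowSorted_cons] at hT
        rw [word_cons, hi_append, lo_of_sorted hT.1, hi_of_sorted hT.2.1] at hc
        omega

theorem word_perm (T : Filling) : (word T).Perm T.flatten := (List.reverse_perm T).flatten

theorem wt_eq (T : Filling) (k : ℕ) : wt T k = (word T).count k :=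
  ((word_perm T).count_eq k).symm

theorem Raise.isTableau_iff {i : ℕ} (hi : 1 ≤ i) {T T' : Filling} (hs : shape T = shape T')
    (h : Raise i (word T) (word T')) : IsTableau T ↔ IsTableau T' := by
  unfold IsTableau
  rw [← h.rowSorted_iff hs]
  refine and_congr_right fun hT => and_congr (h.isChain_iff hi hT hs) ?_
  have h0 := h.count 0
  rw [if_neg (by omega), if_neg (by omega)] at h0
  rw [← List.count_eq_zero, ← List.count_eq_zero, ← (word_perm T).count_eq,
    ← (word_perm T').count_eq]
  omega

theorem RaiseIter.isTableau_iff {i k : ℕ} (hi : 1 ≤ i) {T T' : Filling} (hs : shape T = shape T')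
    (h : RaiseIter i k (word T) (word T')) : IsTableau T ↔ IsTableau T' := by
  induction k generalizing T' with
  | zero => rw [eq_of_word_eq hs h]
  | succ k ih =>
    obtain ⟨v, h1, h2⟩ := h
    obtain ⟨S, h3, rfl⟩ := exists_word_eq T h1.length_eq
    rw [ih h3 h1, h2.isTableau_iff hi (h3.symm.trans hs)]

theorem Reflects.isTableau_iff {i : ℕ} (hi : 1 ≤ i) {T T' : Filling} (hs : shape T = shape T')
    (h : Reflects i (word T) (word T')) : IsTableau T ↔ IsTableau T' := by
  rcases h with ⟨k, h, -⟩ | ⟨k, h, -⟩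
  · exact h.isTableau_iff hi hs
  · exact (h.isTableau_iff hi hs.symm).symm

/-- Domination at level `0`: a `1` below the top row would force a `0` in the row above. -/
theorem IsTableau.onesOnTop {T : Filling} (h : IsTableau T) : OnesOnTop T := by
  obtain ⟨-, hc, h0⟩ := h
  have key : 1 ∉ T.tail.flatten := by
    induction T with
    | nil => simp
    | cons R T ih =>
      rcases T with _ | ⟨S, T⟩
      · simp
      · rw [List.isChain_cons_cons] at hc
        rw [List.flatten_cons, List.mem_append, not_or] at h0
        rw [List.tail_cons, List.flatten_cons, List.mem_append, not_or]
        refine ⟨fun h1 => ?_, ih hc.2 h0.2⟩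
        have h2 := hc.1 0
        have h3 : 0 < S.countP (· ≤ 0 + 1) := List.countP_pos_iff.2 ⟨1, h1, by simp⟩
        obtain ⟨a, ha, ha'⟩ := List.countP_pos_iff.1 (h3.trans_le h2)
        exact h0.1 (by simpa [Nat.le_zero.1 (of_decide_eq_true ha')] using ha)
  refine ⟨fun x hx => Nat.pos_of_ne_zero fun h => h0 (h ▸ hx), fun x hx => ?_⟩
  have h1 : x ≠ 1 := fun h => key (h ▸ hx)
  have h2 : x ≠ 0 := fun h => h0 (h ▸ ?_)
  · omega
  · rcases T with _ | ⟨R, T⟩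
    · exact hx
    · rw [List.flatten_cons]; exact List.mem_append_right _ hx

theorem isTableau_of_mem_crystal {n : ℕ} {lam : YoungDiagram} {T : Filling}
    (h : T ∈ crystal n lam) : IsTableau T := by
  obtain ⟨T, hT, rfl⟩ := h
  refine ⟨?_, ?_, ?_⟩
  · intro R hR
    simp only [rowsOf, List.mem_map, List.mem_range] at hR
    obtain ⟨i, -, rfl⟩ := hR
    rw [List.pairwise_map]
    refine List.pairwise_lt_range.imp_of_mem fun ha hb hab => ?_
    exact T.row_weak hab (YoungDiagram.mem_iff_lt_rowLen.2 (List.mem_range.1 hb))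
  · rw [rowsOf, List.isChain_iff_getElem]
    intro i hi k
    simp only [List.getElem_map, List.getElem_range, List.countP_map]
    have hle : lam.rowLen (i + 1) ≤ lam.rowLen i := lam.rowLen_anti i (i + 1) (Nat.le_succ i)
    refine le_trans ?_ (List.Sublist.countP_le (List.range_sublist.2 hle))
    refine List.countP_mono_left fun j hj hk => ?_
    have := T.col_strict (lt_add_one i)
      (YoungDiagram.mem_iff_lt_rowLen.2 (List.mem_range.1 hj))
    simp only [Function.comp_apply, decide_eq_true_eq] at hk ⊢
    omega
  · simp only [rowsOf, List.mem_flatten, List.mem_map, List.mem_range]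
    rintro ⟨_, ⟨i, -, rfl⟩, h0⟩
    obtain ⟨j, hj, h0⟩ := List.mem_map.1 h0
    have := (hT i j (YoungDiagram.mem_iff_lt_rowLen.2 (List.mem_range.1 hj))).1
    omega

/-! ### Crystal operators on fillings -/

/-- The letters of a reading, in the order of the row word. -/
def letters (r : List ((ℕ × ℕ) × ℕ)) : List ℕ := (r.map Prod.snd).reverse

@[simp] theorem letters_nil : letters [] = [] := rfl

@[simp] theorem letters_cons (p : (ℕ × ℕ) × ℕ) (r : List ((ℕ × ℕ) × ℕ)) :
    letters (p :: r) = letters r ++ [p.2] := by simp [letters]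

@[simp] theorem letters_append (r s : List ((ℕ × ℕ) × ℕ)) :
    letters (r ++ s) = letters s ++ letters r := by simp [letters]

/-- The reading of the row with index `k`, whose cells have columns `m, m + 1, …`. -/
def rowReading (k m : ℕ) (R : List ℕ) : List ((ℕ × ℕ) × ℕ) :=
  ((R.zipIdx m).map fun x => ((k, x.2), x.1)).reverse

/-- The reading of a filling whose rows have indices `k, k + 1, …`. -/
def readingFrom (k : ℕ) (T : Filling) : List ((ℕ × ℕ) × ℕ) :=
  (T.zipIdx k).flatMap fun R => rowReading R.2 0 R.1

theorem reading_eq (T : Filling) : reading T = readingFrom 0 T := rfl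

theorem readingFrom_cons (k : ℕ) (R : List ℕ) (T : Filling) :
    readingFrom k (R :: T) = rowReading k 0 R ++ readingFrom (k + 1) T := by
  simp [readingFrom]

theorem rowReading_cons (k m x : ℕ) (R : List ℕ) :
    rowReading k m (x :: R) = rowReading k (m + 1) R ++ [((k, m), x)] := by
  simp [rowReading]

theorem letters_rowReading (k m : ℕ) (R : List ℕ) : letters (rowReading k m R) = R := by
  induction R generalizing m with
  | nil => rfl
  | cons x R ih => rw [rowReading_cons, letters_append, ih]; rfl

theorem letters_readingFrom (k : ℕ) (T : Filling) : letters (readingFrom k T) = word T := by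
  induction T generalizing k with
  | nil => rfl
  | cons R T ih => rw [readingFrom_cons, letters_append, ih, letters_rowReading, word_cons]

theorem letters_reading (T : Filling) : letters (reading T) = word T := letters_readingFrom 0 T

theorem rowReading_split {k m : ℕ} {R : List ℕ} {r s : List ((ℕ × ℕ) × ℕ)} {p : (ℕ × ℕ) × ℕ}
    (h : rowReading k m R = r ++ p :: s) :
    R = letters s ++ p.2 :: letters r ∧ p.1 = (k, m + (letters s).length) := by
  have h1 := congrArg letters h
  rw [letters_rowReading, letters_append, letters_cons, List.append_assoc,
    List.singleton_append] at h1
  refine ⟨h1, ?_⟩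
  clear h1
  induction R generalizing m s with
  | nil => simp [rowReading] at h
  | cons x R ih =>
    rw [rowReading_cons] at h
    rcases List.eq_nil_or_concat s with rfl | ⟨s, q, rfl⟩
    · have := List.append_inj_right' h rfl
      obtain rfl : ((k, m), x) = p := by simpa using this
      simp
    · rw [List.concat_eq_append, ← List.cons_append, ← List.append_assoc] at h
      have := ih (List.append_inj_left' h rfl)
      rw [this]
      simp; omega

theorem readingFrom_split {k : ℕ} {T : Filling} {r s : List ((ℕ × ℕ) × ℕ)} {p : (ℕ × ℕ) × ℕ}
    (h : readingFrom k T = r ++ p :: s) :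
    ∃ C L H D, T = C ++ (L ++ p.2 :: H) :: D ∧ p.1 = (k + C.length, L.length) ∧
      letters r = H ++ word C ∧ letters s = word D ++ L := by
  induction T generalizing k r with
  | nil => simp [readingFrom] at h
  | cons R T ih =>
    rw [readingFrom_cons] at h
    rcases List.append_eq_append_iff.1 h with ⟨a, rfl, ha⟩ | ⟨a, ha, hs⟩
    · obtain ⟨C, L, H, D, rfl, h1, h2, h3⟩ := ih ha
      refine ⟨R :: C, L, H, D, rfl, ?_, ?_, h3⟩
      · rw [h1, List.length_cons]; congr 1; omega
      · rw [letters_append, h2, letters_rowReading, word_cons, List.append_assoc]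
    · rcases a with _ | ⟨q, a⟩
      · rw [List.append_nil] at ha
        rw [List.nil_append] at hs
        obtain ⟨C, L, H, D, rfl, h1, h2, h3⟩ := ih (r := []) hs.symm
        refine ⟨R :: C, L, H, D, rfl, ?_, ?_, h3⟩
        · rw [h1, List.length_cons]; congr 1; omega
        · rw [← ha, letters_rowReading, word_cons, ← List.append_assoc, ← h2]; rfl
      · rw [List.cons_append, List.cons.injEq] at hs
        obtain ⟨rfl, rfl⟩ := hs
        obtain ⟨h1, h2⟩ := rowReading_split ha
        refine ⟨[], letters a, letters r, T, by rw [← h1]; rfl, by simpa using h2, by simp, ?_⟩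
        rw [letters_append, letters_readingFrom]

theorem relabel_split (C L H D) (x y : ℕ) :
    relabel (C ++ (L ++ x :: H) :: D) (C.length, L.length) y = C ++ (L ++ y :: H) :: D := by
  unfold relabel
  induction C with
  | nil => simp
  | cons R C ih => simpa using ih

/-- The effect of a change of a letter on the row word. -/
theorem word_relabel {T : Filling} {r s : List ((ℕ × ℕ) × ℕ)} {p : (ℕ × ℕ) × ℕ}
    (h : reading T = r ++ p :: s) (y : ℕ) :
    word T = letters s ++ p.2 :: letters r ∧
      word (relabel T p.1 y) = letters s ++ y :: letters r ∧
      shape T = shape (relabel T p.1 y) := by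
  obtain ⟨C, L, H, D, rfl, h1, h2, h3⟩ := readingFrom_split (reading_eq T ▸ h)
  rw [h1, Nat.zero_add, relabel_split, h2, h3]
  simp

/-- The form `(i+1)^r i^s` of the reduced subword, and the position of its letters. -/
theorem reducedSubword_spec (i : ℕ) (r : List ((ℕ × ℕ) × ℕ)) :
    ∃ X Y, reducedSubword i r = X ++ Y ∧ (∀ p ∈ X, p.2 = i + 1) ∧ (∀ p ∈ Y, p.2 = i) ∧
      X.length = hi i (letters r) ∧ Y.length = lo i (letters r) ∧
      (∀ p Y', Y = p :: Y' →
        ∃ s t, r = s ++ p :: t ∧ lo i (letters s) = 0 ∧ hi i (letters t) = 0) ∧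
      (∀ p X', X = X' ++ [p] →
        ∃ s t, r = s ++ p :: t ∧ lo i (letters s) = 0 ∧ hi i (letters t) = 0) := by
  induction r with
  | nil => exact ⟨[], [], rfl, by simp, by simp, rfl, rfl, by simp, by simp⟩
  | cons p r ih =>
    obtain ⟨X, Y, h, hX, hY, hXl, hYl, h1, h2⟩ := ih
    have ext : ∀ {q s t}, r = s ++ q :: t → lo i (letters s ++ [p.2]) = 0 →
        hi i (letters t) = 0 → ∃ s' t', p :: r = s' ++ q :: t' ∧ lo i (letters s') = 0 ∧
          hi i (letters t') = 0 := by
      rintro q s t rfl hs ht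
      exact ⟨p :: s, t, rfl, by rwa [letters_cons], ht⟩
    rw [letters_cons, hi_append, lo_append, hi_singleton, lo_singleton, reducedSubword, h]
    by_cases hp : p.2 = i
    · rw [if_pos hp, if_pos hp, if_neg (by omega)]
      rcases X with _ | ⟨q, X⟩
      · refine ⟨[], p :: Y, ?_, by simp, by simpa [hp] using fun a b c hc => hY _ hc, ?_, ?_, ?_,
          by simp⟩
        · rcases Y with _ | ⟨q, Y⟩
          · rfl
          · have := hY q (by simp)
            simp only [List.nil_append]
            rw [if_neg (by omega)]
        · simp only [List.length_nil] at hXl ⊢; omega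
        · simp only [List.length_nil, List.length_cons] at hXl ⊢; omega
        · intro p' Y' e
          obtain ⟨rfl, -⟩ := List.cons.inj e
          exact ⟨[], r, rfl, rfl, hXl.symm⟩
      -- The new `i` cancels the first letter `q` of `X`. Each recorded splitting survives because
      -- its part `s` contains an unpaired `i + 1` that absorbs the new letter.
      · refine ⟨X, Y, ?_, fun a ha => hX a (List.mem_cons_of_mem _ ha), hY, ?_, ?_, ?_, ?_⟩
        · simp only [List.cons_append]
          rw [if_pos (hX q (by simp))]
        · simp only [List.length_cons] at hXl; omega
        · simp only [List.length_cons] at hXl; omega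
        · intro p' Y' e
          obtain ⟨s, t, rfl, hs, ht⟩ := h1 p' Y' e
          refine ext rfl ?_ ht
          have := hY p' (by simp [e])
          rw [letters_append, letters_cons, hi_append, hi_append, ht, hs, hi_singleton,
            if_neg (by omega), List.length_cons] at hXl
          rw [lo_append, lo_singleton, if_pos hp]
          omega
        · intro p' X' e
          obtain ⟨s, t, rfl, hs, ht⟩ := h2 p' (q :: X') (by rw [e]; rfl)
          refine ext rfl ?_ ht
          have := hX p' (by simp [e])
          rw [letters_append, letters_cons, hi_append, hi_append, ht, hs, hi_singleton,
            if_pos this, e] at hXl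
          simp only [List.length_cons, List.length_append, List.length_nil] at hXl
          rw [lo_append, lo_singleton, if_pos hp]
          omega
    · rw [if_neg hp, if_neg hp]
      by_cases hp' : p.2 = i + 1
      · rw [if_pos hp', if_pos hp']
        have hz : ∀ s, lo i (letters s) = 0 → lo i (letters s ++ [p.2]) = 0 := by
          intro s hs
          rw [lo_append, lo_singleton, if_neg hp, hs]; omega
        refine ⟨p :: X, Y, rfl, by simpa [hp'] using fun a b c hc => hX _ hc, hY,
          by simp only [List.length_cons]; omega, by omega, ?_, ?_⟩
        · intro p' Y' e
          obtain ⟨s, t, e, hs, ht⟩ := h1 p' Y' e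
          exact ext e (hz s hs) ht
        · intro p' X' e
          rcases X' with _ | ⟨q, X'⟩
          · simp only [List.nil_append, List.cons.injEq] at e
            obtain ⟨rfl, rfl⟩ := e
            exact ⟨[], r, rfl, rfl, hXl.symm⟩
          · rw [List.cons_append, List.cons.injEq] at e
            obtain ⟨s, t, e, hs, ht⟩ := h2 p' X' e.2
            exact ext e (hz s hs) ht
      · rw [if_neg hp', if_neg hp']
        have hz : ∀ s, lo i (letters s) = 0 → lo i (letters s ++ [p.2]) = 0 := by
          intro s hs
          rw [lo_append, lo_singleton, if_neg hp, hs]; omega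
        refine ⟨X, Y, rfl, hX, hY, by omega, by omega, ?_, ?_⟩
        · intro p' Y' e
          obtain ⟨s, t, e, hs, ht⟩ := h1 p' Y' e
          exact ext e (hz s hs) ht
        · intro p' X' e
          obtain ⟨s, t, e, hs, ht⟩ := h2 p' X' e
          exact ext e (hz s hs) ht

theorem unpaired_eq {i : ℕ} {T : Filling} {X Y : List ((ℕ × ℕ) × ℕ)}
    (h : reducedSubword i (reading T) = X ++ Y) (hX : ∀ p ∈ X, p.2 = i + 1)
    (hY : ∀ p ∈ Y, p.2 = i) :
    unpaired i i T = Y.map Prod.fst ∧ unpaired i (i + 1) T = X.map Prod.fst := by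
  unfold unpaired
  rw [h, List.filter_append, List.filter_append,
    List.filter_eq_nil_iff.2 (fun p hp => by simp [hX p hp]),
    List.filter_eq_self.2 (fun p hp => by simp [hY p hp]),
    List.filter_eq_self.2 (fun p hp => by simp [hX p hp]),
    List.filter_eq_nil_iff.2 (fun p hp => by simp [hY p hp])]
  simp

/-- The reading is the reverse of the row word, so the leftmost unpaired `i` of the former is the
last one of the latter. -/
theorem crystalF_spec (i : ℕ) (T : Filling) :
    (crystalF i T = none ∧ lo i (word T) = 0) ∨
      ∃ T', crystalF i T = some T' ∧ shape T = shape T' ∧ Raise i (word T) (word T') := by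
  obtain ⟨X, Y, h, hX, hY, -, hYl, h1, -⟩ := reducedSubword_spec i (reading T)
  rw [letters_reading] at hYl
  unfold crystalF
  rw [(unpaired_eq h hX hY).1]
  rcases Y with _ | ⟨p, Y⟩
  · exact .inl ⟨rfl, hYl.symm⟩
  · obtain ⟨s, t, e, hs, ht⟩ := h1 p Y rfl
    obtain ⟨h2, h3, h4⟩ := word_relabel e (i + 1)
    rw [hY p (by simp)] at h2
    exact .inr ⟨_, rfl, h4, _, _, h2, h3, ht, hs⟩

theorem crystalE_spec (i : ℕ) (T : Filling) :
    (crystalE i T = none ∧ hi i (word T) = 0) ∨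
      ∃ T', crystalE i T = some T' ∧ shape T = shape T' ∧ Raise i (word T') (word T) := by
  obtain ⟨X, Y, h, hX, hY, hXl, -, -, h1⟩ := reducedSubword_spec i (reading T)
  rw [letters_reading] at hXl
  unfold crystalE
  rw [(unpaired_eq h hX hY).2]
  rcases List.eq_nil_or_concat X with rfl | ⟨X, p, rfl⟩
  · exact .inl ⟨rfl, hXl.symm⟩
  · rw [List.concat_eq_append] at *
    obtain ⟨s, t, e, hs, ht⟩ := h1 p X rfl
    obtain ⟨h2, h3, h4⟩ := word_relabel e i
    rw [hX p (by simp)] at h2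
    exact .inr ⟨_, by simp, h4, _, _, h3, h2, ht, hs⟩

theorem iter_crystalF {i k : ℕ} {T : Filling} (h : k ≤ lo i (word T)) :
    ∃ T', iter (crystalF i) k T = some T' ∧ shape T = shape T' ∧
      RaiseIter i k (word T) (word T') := by
  induction k with
  | zero => exact ⟨T, rfl, rfl, rfl⟩
  | succ k ih =>
    obtain ⟨S, h1, h2, h3⟩ := ih (by omega)
    have := h3.signature
    rcases crystalF_spec i S with ⟨-, h4⟩ | ⟨T', h4, h5, h6⟩
    · omega
    · exact ⟨T', by rw [iter, h1, Option.bind_some, h4], h2.trans h5, _, h3, h6⟩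

theorem iter_crystalE {i k : ℕ} {T : Filling} (h : k ≤ hi i (word T)) :
    ∃ T', iter (crystalE i) k T = some T' ∧ shape T = shape T' ∧
      RaiseIter i k (word T') (word T) := by
  induction k with
  | zero => exact ⟨T, rfl, rfl, rfl⟩
  | succ k ih =>
    obtain ⟨S, h1, h2, h3⟩ := ih (by omega)
    have := h3.signature
    rcases crystalE_spec i S with ⟨-, h4⟩ | ⟨T', h4, h5, h6⟩
    · omega
    · exact ⟨T', by rw [iter, h1, Option.bind_some, h4], h2.trans h5, h3.head h6⟩

/-- The exponent is `lo - hi` or `hi - lo`, hence at most the number of available steps, and the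
default of `getD` is never reached. -/
theorem reflects_kashiwaraReflection (i : ℕ) (T : Filling) :
    shape T = shape (kashiwaraReflection i T) ∧
      Reflects i (word T) (word (kashiwaraReflection i T)) := by
  have hc := count_signature i (word T)
  rw [← wt_eq, ← wt_eq] at hc
  unfold kashiwaraReflection
  split_ifs with h
  · obtain ⟨T', h1, h2, h3⟩ := iter_crystalF (i := i) (k := wt T i - wt T (i + 1)) (T := T)
      (by omega)
    rw [h1]
    exact ⟨h2, .inl ⟨_, h3, by omega⟩⟩
  · obtain ⟨T', h1, h2, h3⟩ := iter_crystalE (i := i) (k := wt T (i + 1) - wt T i) (T := T)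
      (by omega)
    rw [h1]
    have := h3.signature
    exact ⟨h2, .inr ⟨_, h3, by simp only [Option.getD_some]; omega⟩⟩

/-! ### Weights and cocharge under the Kashiwara action -/

theorem RaiseIter.count {i m : ℕ} {w w' : List ℕ} (h : RaiseIter i m w w') (k : ℕ) :
    w'.count k + (if k = i then m else 0) = w.count k + (if k = i + 1 then m else 0) := by
  induction m generalizing w' with
  | zero => obtain rfl : w = w' := h; simp
  | succ m ih =>
    obtain ⟨v, h1, h2⟩ := h
    have h3 := ih h1
    have h4 := h2.count k
    split_ifs at * <;> omega

theorem Reflects.count {i : ℕ} {w w' : List ℕ} (h : Reflects i w w') (k : ℕ) :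
    w'.count k = w.count (simpleReflection i k) := by
  have key : ∀ {w w' : List ℕ} {m : ℕ}, RaiseIter i m w w' → lo i w = hi i w + m →
      w'.count k = w.count (simpleReflection i k) ∧
      w.count k = w'.count (simpleReflection i k) := by
    intro w w' m h hm
    have h1 := h.count i
    have h2 := h.count (i + 1)
    have h3 := h.count k
    have h4 := count_signature i w
    rw [if_pos rfl, if_neg (by omega)] at h1
    rw [if_neg (by omega), if_pos rfl] at h2
    unfold simpleReflection
    by_cases hk : k = i
    · subst hk; rw [Equiv.swap_apply_left]; omega
    · by_cases hk' : k = i + 1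
      · subst hk'; rw [Equiv.swap_apply_right]; omega
      · rw [Equiv.swap_apply_of_ne_of_ne hk hk']
        rw [if_neg hk, if_neg hk'] at h3
        omega
  rcases h with ⟨m, h, hm⟩ | ⟨m, h, hm⟩
  · exact (key h hm).1
  · exact (key h hm).2

theorem kashiwaraAction_spec {u : List ℕ} (hu : ∀ i ∈ u, 1 ≤ i) {T : Filling} (hT : IsTableau T) :
    IsTableau (kashiwaraAction u T) ∧ cocharge (kashiwaraAction u T) = cocharge T ∧
      ∀ k, wt (kashiwaraAction u T) k = wt T ((u.map simpleReflection).prod⁻¹ k) := by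
  induction u with
  | nil => exact ⟨hT, rfl, fun k => rfl⟩
  | cons i u ih =>
    obtain ⟨h1, h2, h3⟩ := ih fun j hj => hu j (List.mem_cons_of_mem _ hj)
    obtain ⟨h4, h5⟩ := reflects_kashiwaraReflection i (kashiwaraAction u T)
    have h6 := (h5.isTableau_iff (hu i (by simp)) h4).1 h1
    refine ⟨h6, (cocharge_eq_of_reflects h1.1 h6.1 h4 h5).symm.trans h2, fun k => ?_⟩
    have h7 : kashiwaraAction (i :: u) T = kashiwaraReflection i (kashiwaraAction u T) := rfl
    rw [h7, wt_eq, h5.count, ← wt_eq, h3, List.map_cons, List.prod_cons, mul_inv_rev,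
      Equiv.Perm.mul_apply]
    congr 2

theorem prod_simpleReflection_reverse (u : List ℕ) :
    (u.reverse.map simpleReflection).prod = (u.map simpleReflection).prod⁻¹ := by
  rw [List.prod_inv_reverse, List.map_reverse, List.map_map]
  congr 3

theorem height_eps_sub {n i j : ℕ} (hi : 1 ≤ i) (hij : i < j) (hj : j ≤ n) :
    height n (eps i - eps j) = j - i := by
  have hc : ∀ k, simpleCoeff (eps i - eps j) k = if i ≤ k ∧ k < j then 1 else 0 := by
    intro k
    simp only [simpleCoeff, eps, Pi.sub_apply, Finset.sum_sub_distrib, Pi.single_apply,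
      Finset.sum_ite_eq', Finset.mem_Icc]
    split_ifs <;> omega
  have hf : (Finset.Ico 1 n).filter (fun k => i ≤ k ∧ k < j) = Finset.Ico i j := by
    ext k
    simp only [Finset.mem_Ico, Finset.mem_filter]
    omega
  simp only [height, hc]
  rw [← Finset.sum_filter, hf]
  simp only [Finset.sum_const, Nat.card_Ico, nsmul_eq_mul, mul_one]
  omega

theorem weightNorm_of_sub {n i j : ℕ} (hi : 1 ≤ i) (hij : i < j) (hj : j ≤ n) {μ ν : ℕ → ℕ}
    (h : ∀ k, (ν k : ℤ) = μ k - (eps i - eps j) k) :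
    weightNorm n ν = weightNorm n μ + (j - i) := by
  have hs : ∀ m, 1 ≤ m → m ≤ n →
      ∑ k ∈ Finset.Icc 1 n, ((k : ℤ) - 1) * eps m k = m - 1 := by
    intro m h1 h2
    simp only [eps, Pi.single_apply, mul_ite, mul_one, mul_zero, Finset.sum_ite_eq',
      Finset.mem_Icc, h1, h2, and_self, if_true]
  simp only [weightNorm, h, Pi.sub_apply, mul_sub, Finset.sum_sub_distrib]
  simp only [hs i hi (by omega), hs j (by omega) hj]
  ring

end TypeA

theorem proposition5p10 (n : ℕ) (lam : YoungDiagram) (T : TypeA.Filling)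
    (hT : T ∈ TypeA.crystal n lam) (α : ℕ → ℤ) (hα : TypeA.IsPositiveRoot n α)
    (w : Equiv.Perm ℕ) (hw : TypeA.IsShortestTo n w α)
    (u : List ℕ) (hu : TypeA.IsReducedExpression n u w)
    (U : TypeA.Filling) (hU : TypeA.modifiedF u T = some U) :
    TypeA.cocharge U = TypeA.cocharge T ∧
      TypeA.charge n U = TypeA.charge n T + TypeA.height n α := by
  open TypeA in
  have hu1 : ∀ i ∈ u, 1 ≤ i := fun i hi => (hu.1.1 i hi).1
  have hprod : (u.map simpleReflection).prod = w := hu.1.2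
  obtain ⟨h1, h2, h3⟩ := kashiwaraAction_spec (u := u.reverse)
    (fun i hi => hu1 i (List.mem_reverse.1 hi)) (isTableau_of_mem_crystal hT)
  rw [prod_simpleReflection_reverse, hprod, inv_inv] at h3
  set V := kashiwaraAction u.reverse T with hV
  rw [modifiedF, ← hV] at hU
  rcases crystalF_spec 1 V with ⟨h4, -⟩ | ⟨V', h4, h5, h6⟩
  · simp [h4] at hU
  rw [h4, Option.map_some, Option.some.injEq] at hU
  subst hU
  obtain ⟨h7, h8, h9⟩ := kashiwaraAction_spec hu1 ((h6.isTableau_iff le_rfl h5).1 h1)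
  rw [hprod] at h9
  have hco : cocharge (kashiwaraAction u V') = cocharge T := by
    rw [h8, ← cocharge_eq_of_raise_one h1.1 h1.onesOnTop h5 h6, h2]
  refine ⟨hco, ?_⟩
  -- `f̃_1` subtracts `α_1` from the weight `w⁻¹(wt T)` of `V`; acting by `w` turns this into
  -- subtracting `w(α_1) = α` from `wt T`.
  have hwt : ∀ k, (wt (kashiwaraAction u V') k : ℤ) = wt T k - α k := by
    intro k
    have h10 := h6.count (w⁻¹ k)
    rw [← wt_eq, ← wt_eq, h3, show w (w⁻¹ k) = k from w.apply_symm_apply k] at h10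
    rw [h9, ← hw.2.1]
    simp only [permWeight, simpleRoot, eps, Pi.sub_apply, Pi.single_apply]
    split_ifs at * <;> omega
  obtain ⟨i, j, hi, hij, hj, rfl⟩ := hα
  rw [charge, charge, hco, height_eps_sub hi hij hj, weightNorm_of_sub hi hij hj hwt]
  ring
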